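/- **Proposition (spectrum of the localised Hodge Laplacian of the Heisenberg group).** Let $H=\mathbb R^3$ be the Heisenberg group with the product $(a,b,t)(a',b',t')=(a+a',b+b',t+t'+ab')$, and with the left invariant Riemannian metric for which the left invariant vector fields $X=\partial_a$, $Y=\partial_b+a\,\partial_t$, $T=\partial_t$ are orthonormal, so that $da$, $db$, $\theta=dt-a\,db$ is an orthonormal coframe; orient $H$ by $da\wedge db\wedge\theta$. Let $\Delta^{(q)}=d\delta+\delta d$ be the Hodge Laplace operator on $q$-forms, $q=0,1,2,3$, written in this coframe as a matrix of left invariant differential operators. For $h\in\mathbb R\setminus\{0\}$ let $\rho_h$ be the Schrödinger representation of $H$ on $L^2(\mathbb R)$, $(\rho_h(a,b,t)f)(x)=e^{2\pi i ht+2\pi i bx}f(x+ha)$, and let $d\rho_h(\Delta^{(q)})$ be the localisation of $\Delta^{(q)}$ at $\rho_h$: the closed operator on $L^2(\mathbb R)\otimes\Lambda^q\mathbb R^3$ that is the closure of the operator obtained on the smooth vectors of $\rho_h$ by replacing each left invariant differential operator $P$ by $d\rho_h(P)u=P\big(g\mapsto\rho_h(g)u\big)(e)$. Put $k=2\pi h$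 and, for $m=0,1,2,\dots$, $$\alpha_m=(2m+1)|k|+k^2,\qquad \beta_m^{\pm}=\left(\sqrt{|k|(2m+1)+k^2+\tfrac14}\pm\tfrac12\right)^2 .$$ Then the spectra are $$\mathrm{Sp}\,d\rho_h(\Delta^{(0)})=\{\alpha_m\}_{m\ge 0},\qquad \mathrm{Sp}\,d\rho_h(\Delta^{(1)})=\{k^2,(|k|+1)^2\}\cup\{\alpha_m\}_{m\ge0}\cup\{\beta_m^{+},\beta_m^{-}\}_{m\ge 0},$$ $$\mathrm{Sp}\,d\rho_h(\Delta^{(2)})=\mathrm{Sp}\,d\rho_h(\Delta^{(1)}),\qquad \mathrm{Sp}\,d\rho_h(\Delta^{(3)})=\mathrm{Sp}\,d\rho_h(\Delta^{(0)}).$$ For $q=0,3$ each eigenvalue has multiplicity one. For $q=1,2$ the multiplicity of each real number $\lambda$ as an eigenvalue (zero if it is not one) is the number of times $\lambda$ occurs in the three sequences $(\alpha_m)_{m\ge0}$, $(\beta^+_m)_{m\ge0}$, $(\beta^-_m)_{m\ge0}$ (where $\beta_0^-=k^2$ and $\beta_0^+=(|k|+1)^2$, so that these two numbers are not counted a second time).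 In particular, when $k$ is irrational, no two entries of these sequences coincide and each eigenvalue has multiplicity one for $q=1,2$ as well. -/

import Mathlib

open MeasureTheory
open scoped ContDiff

noncomputable section

namespace HeisenbergHodge

/-! ## The Heisenberg group -/

/-- The (polarised) three dimensional Heisenberg group, with its global coordinates `a, b, t`. -/
@[ext]
structure Heisenberg where
  a : ℝ
  b : ℝ
  t : ℝ

namespace Heisenberg

instance : Mul Heisenberg := ⟨fun g g' => ⟨g.a + g'.a, g.b + g'.b, g.t + g'.t + g.a * g'.b⟩⟩
instance : One Heisenberg := ⟨⟨0, 0, 0⟩⟩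
instance : Inv Heisenberg := ⟨fun g => ⟨-g.a, -g.b, -g.t + g.a * g.b⟩⟩

theorem mul_def (g g' : Heisenberg) :
    g * g' = ⟨g.a + g'.a, g.b + g'.b, g.t + g'.t + g.a * g'.b⟩ := rfl
theorem one_def : (1 : Heisenberg) = ⟨0, 0, 0⟩ := rfl
theorem inv_def (g : Heisenberg) : g⁻¹ = ⟨-g.a, -g.b, -g.t + g.a * g.b⟩ := rfl

instance : Group Heisenberg :=
  Group.ofLeftAxioms
    (by intro x y z; simp only [mul_def]; ext <;> simp <;> ring)
    (by intro x; simp only [mul_def, one_def]; ext <;> simp)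
    (by intro x; simp only [mul_def, one_def, inv_def]; ext <;> simp)

/-- The point of the group with given global coordinates. -/
def ofCoord (p : ℝ × ℝ × ℝ) : Heisenberg := ⟨p.1, p.2.1, p.2.2⟩

/-- The global coordinates of a point of the group. -/
def coord (g : Heisenberg) : ℝ × ℝ × ℝ := (g.a, g.b, g.t)

end Heisenberg

open Heisenberg

/-! ## Smooth functions and left invariant vector fields on the group

Functions take values in a complex normed space `E`. -/

section Smooth

variable (E : Type*) [NormedAddCommGroup E] [NormedSpace ℂ E]

/-- The space of smooth functions from the Heisenberg group to `E`. -/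
def SmoothFun : Submodule ℂ (Heisenberg → E) where
  carrier := {F | ContDiff ℝ ∞ (F ∘ ofCoord)}
  add_mem' := fun {F G} hF hG => by
    have hF' : ContDiff ℝ ∞ (F ∘ ofCoord) := hF
    have hG' : ContDiff ℝ ∞ (G ∘ ofCoord) := hG
    exact hF'.add hG'
  zero_mem' := by
    change ContDiff ℝ ∞ (fun _ : ℝ × ℝ × ℝ => (0 : E))
    exact contDiff_const
  smul_mem' := fun c F hF => by
    have hF' : ContDiff ℝ ∞ (F ∘ ofCoord) := hF
    exact hF'.const_smul c

variable {E}

theorem smoothFun_differentiableAt (F : SmoothFun E) (p : ℝ × ℝ × ℝ) :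
    DifferentiableAt ℝ (F.1 ∘ ofCoord) p :=
  (show ContDiff ℝ ∞ (F.1 ∘ ofCoord) from F.2).differentiable (by simp) p

variable (E)

/-- The first order differential operator on smooth functions given by the vector field
`x ∂_a + y (∂_b + a ∂_t) + z ∂_t`, the left invariant vector field with value
`v = (x, y, z)` at the unit element. -/
def leftField (v : ℝ × ℝ × ℝ) : Module.End ℂ (SmoothFun E) where
  toFun F := ⟨fun g => fderiv ℝ (F.1 ∘ ofCoord) (coord g) (v.1, v.2.1, v.2.2 + g.a * v.2.1), by
    have hF : ContDiff ℝ ∞ (F.1 ∘ ofCoord) := F.2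
    change ContDiff ℝ ∞ (fun p : ℝ × ℝ × ℝ =>
      fderiv ℝ (F.1 ∘ ofCoord) p (v.1, v.2.1, v.2.2 + p.1 * v.2.1))
    have h1 : ContDiff ℝ ∞ (fderiv ℝ (F.1 ∘ ofCoord)) := hF.fderiv_right (by simp)
    exact h1.clm_apply (by fun_prop)⟩
  map_add' F G := by
    ext g
    change fderiv ℝ (F.1 ∘ ofCoord + G.1 ∘ ofCoord) (coord g) _ = _
    rw [fderiv_add (smoothFun_differentiableAt F _) (smoothFun_differentiableAt G _)]
    rfl
  map_smul' c F := by
    ext g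
    change fderiv ℝ (c • (F.1 ∘ ofCoord)) (coord g) _ = _
    rw [fderiv_const_smul (smoothFun_differentiableAt F _)]
    rfl

/-- `X = ∂_a`. -/
def fieldX : Module.End ℂ (SmoothFun E) := leftField E (1, 0, 0)
/-- `Y = ∂_b + a ∂_t`. -/
def fieldY : Module.End ℂ (SmoothFun E) := leftField E (0, 1, 0)
/-- `T = ∂_t`. -/
def fieldT : Module.End ℂ (SmoothFun E) := leftField E (0, 0, 1)

end Smooth

/-! ## The Hodge Laplace operator of the group

Smooth differential forms are given by their components with respect to the left invariant
orthonormal coframe `da, db, θ = dt - a db`, whose only nontrivial structure equation is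
`dθ = - da ∧ db`. The frames of the bundles of forms are
* degree 0: `1`;
* degree 1: `da, db, θ`;
* degree 2: `da ∧ db, da ∧ θ, db ∧ θ`;
* degree 3: `da ∧ db ∧ θ` (the Riemannian volume form).

Operators between forms are matrices of left invariant differential operators. -/

section Hodge

variable (E : Type*) [NormedAddCommGroup E] [NormedSpace ℂ E]

/-- The exterior derivative from functions to 1-forms. -/
def extD0 : Matrix (Fin 3) (Fin 1) (Module.End ℂ (SmoothFun E)) :=
  !![fieldX E; fieldY E; fieldT E]

/-- The exterior derivative from 1-forms to 2-forms. -/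
def extD1 : Matrix (Fin 3) (Fin 3) (Module.End ℂ (SmoothFun E)) :=
  !![-fieldY E, fieldX E, -1;
     -fieldT E, 0, fieldX E;
     0, -fieldT E, fieldY E]

/-- The exterior derivative from 2-forms to 3-forms. -/
def extD2 : Matrix (Fin 1) (Fin 3) (Module.End ℂ (SmoothFun E)) :=
  !![fieldT E, -fieldY E, fieldX E]

/-- The Hodge star between 1-forms and 2-forms (in both directions):
`⋆da = db ∧ θ`, `⋆db = - da ∧ θ`, `⋆θ = da ∧ db`, and `⋆⋆ = 1`. -/
def hodgeStar : Matrix (Fin 3) (Fin 3) (Module.End ℂ (SmoothFun E)) :=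
  !![0, 0, 1;
     0, -1, 0;
     1, 0, 0]

/-- The Hodge star between functions and 3-forms (in both directions):
`⋆1 = da ∧ db ∧ θ`. -/
def hodgeStarTop : Matrix (Fin 1) (Fin 1) (Module.End ℂ (SmoothFun E)) := 1

/-- The codifferential `δ = - ⋆ d ⋆` from 1-forms to functions. -/
def codiff1 : Matrix (Fin 1) (Fin 3) (Module.End ℂ (SmoothFun E)) :=
  -(hodgeStarTop E * extD2 E * hodgeStar E)

/-- The codifferential `δ = ⋆ d ⋆` from 2-forms to 1-forms
(in dimension 3, the formal adjoint of `d` on `q`-forms is `(-1)^q ⋆ d ⋆`). -/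
def codiff2 : Matrix (Fin 3) (Fin 3) (Module.End ℂ (SmoothFun E)) :=
  hodgeStar E * extD1 E * hodgeStar E

/-- The codifferential `δ = - ⋆ d ⋆` from 3-forms to 2-forms. -/
def codiff3 : Matrix (Fin 3) (Fin 1) (Module.End ℂ (SmoothFun E)) :=
  -(hodgeStar E * extD0 E * hodgeStarTop E)

/-- The Hodge Laplace operator `δ d` on functions. -/
def hodgeLaplacian0 : Matrix (Fin 1) (Fin 1) (Module.End ℂ (SmoothFun E)) :=
  codiff1 E * extD0 E

/-- The Hodge Laplace operator `d δ + δ d` on 1-forms. -/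
def hodgeLaplacian1 : Matrix (Fin 3) (Fin 3) (Module.End ℂ (SmoothFun E)) :=
  extD0 E * codiff1 E + codiff2 E * extD1 E

/-- The Hodge Laplace operator `d δ + δ d` on 2-forms. -/
def hodgeLaplacian2 : Matrix (Fin 3) (Fin 3) (Module.End ℂ (SmoothFun E)) :=
  extD1 E * codiff2 E + codiff3 E * extD2 E

/-- The Hodge Laplace operator `d δ` on 3-forms. -/
def hodgeLaplacian3 : Matrix (Fin 1) (Fin 1) (Module.End ℂ (SmoothFun E)) :=
  extD2 E * codiff3 E

end Hodge

/-! ## The Schrödinger representation -/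

/-- The Hilbert space `L²(ℝ)`. -/
abbrev L2R : Type := Lp ℂ 2 (volume : Measure ℝ)

/-- The phase `exp (2 π i h t + 2 π i b x)`. -/
def phase (h : ℝ) (g : Heisenberg) (x : ℝ) : ℂ :=
  Complex.exp ((2 * Real.pi * (h * g.t + g.b * x) : ℝ) * Complex.I)

theorem norm_phase (h : ℝ) (g : Heisenberg) (x : ℝ) : ‖phase h g x‖ = 1 :=
  Complex.norm_exp_ofReal_mul_I _

theorem continuous_phase (h : ℝ) (g : Heisenberg) : Continuous (phase h g) := by
  unfold phase; fun_prop

/-- `x ↦ exp (2 π i h t + 2 π i b x) f (x + h a)`. -/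
def schrodingerFun (h : ℝ) (g : Heisenberg) (f : ℝ → ℂ) (x : ℝ) : ℂ :=
  phase h g x * f (x + h * g.a)

theorem memLp_schrodingerFun (h : ℝ) (g : Heisenberg) {f : ℝ → ℂ} (hf : MemLp f 2 volume) :
    MemLp (schrodingerFun h g f) 2 volume := by
  have h1 : MemLp (fun x => f (x + h * g.a)) 2 volume :=
    hf.comp_measurePreserving (measurePreserving_add_right volume (h * g.a))
  refine h1.of_le ((continuous_phase h g).aestronglyMeasurable.mul h1.1) ?_
  exact Filter.Eventually.of_forall fun x => by simp [schrodingerFun, norm_phase]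

theorem schrodingerFun_congr (h : ℝ) (g : Heisenberg) {f f' : ℝ → ℂ} (hf : f =ᵐ[volume] f') :
    schrodingerFun h g f =ᵐ[volume] schrodingerFun h g f' := by
  have h1 := (measurePreserving_add_right (volume : Measure ℝ)
    (h * g.a)).quasiMeasurePreserving.ae_eq_comp hf
  filter_upwards [h1] with x hx
  have hx' : f (x + h * g.a) = f' (x + h * g.a) := hx
  simp [schrodingerFun, hx']

/-- The operator `ρ_h(g)` on `L²(ℝ)`. -/
def schrodingerOp (h : ℝ) (g : Heisenberg) : L2R →ₗᵢ[ℂ] L2R where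
  toFun f := (memLp_schrodingerFun h g (Lp.memLp f)).toLp _
  map_add' f f' := by
    rw [← MemLp.toLp_add]
    refine MemLp.toLp_congr _ _ ((schrodingerFun_congr h g (Lp.coeFn_add f f')).trans ?_)
    exact Filter.Eventually.of_forall fun x => by simp [schrodingerFun, mul_add]
  map_smul' c f := by
    rw [RingHom.id_apply, ← MemLp.toLp_const_smul]
    refine MemLp.toLp_congr _ _ ((schrodingerFun_congr h g (Lp.coeFn_smul c f)).trans ?_)
    exact Filter.Eventually.of_forall fun x => by simp [schrodingerFun, mul_left_comm]
  norm_map' f := by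
    change ‖(memLp_schrodingerFun h g (Lp.memLp f)).toLp _‖ = ‖f‖
    have h1 := Lp.memLp f
    rw [Lp.norm_toLp, Lp.norm_def]
    congr 1
    have h2 : eLpNorm (schrodingerFun h g f) 2 volume
        = eLpNorm (fun x => f (x + h * g.a)) 2 volume :=
      eLpNorm_congr_norm_ae (Filter.Eventually.of_forall fun x => by
        simp [schrodingerFun, norm_phase])
    rw [h2]
    exact eLpNorm_comp_measurePreserving h1.1 (measurePreserving_add_right volume (h * g.a))

theorem coeFn_schrodingerOp (h : ℝ) (g : Heisenberg) (f : L2R) :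
    schrodingerOp h g f =ᵐ[volume] schrodingerFun h g f :=
  MemLp.coeFn_toLp (memLp_schrodingerFun h g (Lp.memLp f))

theorem schrodingerOp_one (h : ℝ) (f : L2R) : schrodingerOp h 1 f = f := by
  refine Lp.ext ((coeFn_schrodingerOp h 1 f).trans ?_)
  exact Filter.Eventually.of_forall fun x => by simp [schrodingerFun, phase, one_def]

theorem schrodingerOp_mul (h : ℝ) (g g' : Heisenberg) (f : L2R) :
    schrodingerOp h (g * g') f = schrodingerOp h g (schrodingerOp h g' f) := by
  refine Lp.ext ((coeFn_schrodingerOp h (g * g') f).trans (Filter.EventuallyEq.symm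
    ((coeFn_schrodingerOp h g _).trans
      ((schrodingerFun_congr h g (coeFn_schrodingerOp h g' f)).trans ?_))))
  refine Filter.Eventually.of_forall fun x => ?_
  simp only [schrodingerFun, phase, mul_def]
  rw [← mul_assoc, ← Complex.exp_add]
  congr 2
  · push_cast; ring
  · ring

/-- The Schrödinger representation `ρ_h` of the Heisenberg group by unitary operators on `L²(ℝ)`,
`(ρ_h(a, b, t) f)(x) = exp (2 π i h t + 2 π i b x) f (x + h a)`. -/
def schrodinger (h : ℝ) : Heisenberg →* (L2R ≃ₗᵢ[ℂ] L2R) where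
  toFun g := LinearIsometryEquiv.mk
    (LinearEquiv.ofLinearMap (schrodingerOp h g).toLinearMap (schrodingerOp h g⁻¹).toLinearMap
      (by ext1 f
          change schrodingerOp h g (schrodingerOp h g⁻¹ f) = f
          rw [← schrodingerOp_mul, mul_inv_cancel, schrodingerOp_one])
      (by ext1 f
          change schrodingerOp h g⁻¹ (schrodingerOp h g f) = f
          rw [← schrodingerOp_mul, inv_mul_cancel, schrodingerOp_one]))
    (fun f => (schrodingerOp h g).norm_map f)
  map_one' := by
    refine LinearIsometryEquiv.ext fun f => ?_
    exact schrodingerOp_one h f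
  map_mul' g g' := by
    refine LinearIsometryEquiv.ext fun f => ?_
    exact schrodingerOp_mul h g g' f

/-! ## Localisation at `ρ_h`

A left invariant differential operator `P` on the group acts on the smooth vectors of a
representation `ρ` by `dρ(P) u = P (g ↦ ρ(g) u) (1)`; for `P = X_1 ⋯ X_r` a product of left
invariant vector fields this is `dρ(X_1) ⋯ dρ(X_r) u`, where
`dρ(X) u` is the derivative at `0` of `s ↦ ρ(exp(s X)) u`. -/

/-- The orbit map `g ↦ ρ_h(g) u`. -/
def orbit (h : ℝ) (u : L2R) : Heisenberg → L2R := fun g => schrodinger h g u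

/-- The Hilbert space `L²(ℝ) ⊗ ℂⁿ` of vectors with `n` components in `L²(ℝ)`. -/
abbrev L2Forms (n : ℕ) : Type := PiLp 2 (fun _ : Fin n => L2R)

/-- The vectors all of whose components are smooth vectors of `ρ_h`. -/
def smoothVectors (h : ℝ) (n : ℕ) : Submodule ℂ (L2Forms n) where
  carrier := {u | ∀ i, orbit h (u i) ∈ SmoothFun L2R}
  add_mem' := fun {u v} hu hv i => by
    have : orbit h ((u + v) i) = orbit h (u i) + orbit h (v i) := by
      funext g; simp [orbit]
    rw [this]; exact (SmoothFun L2R).add_mem (hu i) (hv i)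
  zero_mem' := fun i => by
    have : orbit h ((0 : L2Forms n) i) = 0 := by
      funext g; simp [orbit]
    rw [this]; exact (SmoothFun L2R).zero_mem
  smul_mem' := fun c u hu i => by
    have : orbit h ((c • u) i) = c • orbit h (u i) := by
      funext g; simp [orbit]
    rw [this]; exact (SmoothFun L2R).smul_mem c (hu i)

/-- The tuple of orbit maps of a tuple of smooth vectors, a tuple of smooth functions on the
group. -/
def orbitTuple (h : ℝ) (n : ℕ) : smoothVectors h n →ₗ[ℂ] (Fin n → SmoothFun L2R) where
  toFun u := fun i => ⟨orbit h (u.1 i), u.2 i⟩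
  map_add' u v := by
    funext i; apply Subtype.ext; funext g
    change schrodinger h g ((u.1 + v.1) i) = schrodinger h g (u.1 i) + schrodinger h g (v.1 i)
    simp
  map_smul' c u := by
    funext i; apply Subtype.ext; funext g
    change schrodinger h g ((c • u.1) i) = c • schrodinger h g (u.1 i)
    simp

/-- Evaluation at the unit element. -/
def evalOne : SmoothFun L2R →ₗ[ℂ] L2R where
  toFun F := F.1 1
  map_add' _ _ := rfl
  map_smul' _ _ := rfl

/-- The operator `dρ_h(P)` on the smooth vectors, for a matrix `P` of left invariant differential
operators: the `i`-th component of `dρ_h(P) u` is the value at the unit element of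
`∑ j, P i j (g ↦ ρ_h(g) u_j)`. -/
def localiseSmooth (h : ℝ) {n : ℕ}
    (P : Matrix (Fin n) (Fin n) (Module.End ℂ (SmoothFun L2R))) :
    L2Forms n →ₗ.[ℂ] L2Forms n where
  domain := smoothVectors h n
  toFun := (WithLp.linearEquiv 2 ℂ (Fin n → L2R)).symm.toLinearMap ∘ₗ
    LinearMap.pi (fun i => evalOne ∘ₗ ∑ j, P i j ∘ₗ LinearMap.proj j) ∘ₗ orbitTuple h n

/-- The localisation of `P` at `ρ_h`: the closure of `dρ_h(P)` on the smooth vectors. -/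
def localise (h : ℝ) {n : ℕ}
    (P : Matrix (Fin n) (Fin n) (Module.End ℂ (SmoothFun L2R))) :
    L2Forms n →ₗ.[ℂ] L2Forms n :=
  (localiseSmooth h P).closure

/-! ## Spectrum of unbounded operators -/

section Spectrum

variable {K : Type*} [NormedAddCommGroup K] [NormedSpace ℂ K]

/-- `z` is in the resolvent set of `A` if `A - z` is a bijection of the domain of `A` onto the
whole space with bounded inverse. -/
def InResolventSet (A : K →ₗ.[ℂ] K) (z : ℂ) : Prop :=
  ∃ R : K →L[ℂ] K,
    (∀ y, ∃ hy : R y ∈ A.domain, A ⟨R y, hy⟩ - z • R y = y) ∧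
    ∀ x : A.domain, R (A x - z • (x : K)) = x

/-- The spectrum of an unbounded operator. -/
def unboundedSpectrum (A : K →ₗ.[ℂ] K) : Set ℂ := {z | ¬ InResolventSet A z}

/-- The eigenspace `{x ∈ D(A) | A x = z x}`. -/
def eigenspace (A : K →ₗ.[ℂ] K) (z : ℂ) : Submodule ℂ A.domain :=
  LinearMap.ker (A.toFun - z • A.domain.subtype)

/-- The (geometric) multiplicity of `z` as an eigenvalue of `A`. -/
def eigenMultiplicity (A : K →ₗ.[ℂ] K) (z : ℂ) : ℕ := Module.finrank ℂ (eigenspace A z)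

end Spectrum

/-! ## The lists of eigenvalues -/

/-- `(2 m + 1) |k| + k²`. -/
def eigA (k : ℝ) (m : ℕ) : ℝ := (2 * m + 1) * |k| + k ^ 2

/-- `(√(|k| (2 m + 1) + k² + 1/4) + 1/2)²`. -/
def eigPlus (k : ℝ) (m : ℕ) : ℝ := (√(|k| * (2 * m + 1) + k ^ 2 + 1 / 4) + 1 / 2) ^ 2

/-- `(√(|k| (2 m + 1) + k² + 1/4) - 1/2)²`. -/
def eigMinus (k : ℝ) (m : ℕ) : ℝ := (√(|k| * (2 * m + 1) + k ^ 2 + 1 / 4) - 1 / 2) ^ 2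

/-- The set of eigenvalues on functions. -/
def functionSpectrum (k : ℝ) : Set ℝ := {x | ∃ m : ℕ, x = eigA k m}

/-- The set of eigenvalues on 1-forms. -/
def oneFormSpectrum (k : ℝ) : Set ℝ :=
  {k ^ 2, (|k| + 1) ^ 2} ∪ {x | ∃ m : ℕ, x = eigA k m} ∪
    {x | ∃ m : ℕ, x = eigPlus k m ∨ x = eigMinus k m}

/-- The number of indices at which `x` occurs in the three sequences `eigA`, `eigPlus` and
`eigMinus`. As `eigMinus k 0 = k²` and `eigPlus k 0 = (|k| + 1)²`, these three sequences
list all the elements of `oneFormSpectrum k`. -/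
def oneFormCount (k x : ℝ) : ℕ :=
  {m : ℕ | eigA k m = x}.ncard + {m : ℕ | eigPlus k m = x}.ncard +
    {m : ℕ | eigMinus k m = x}.ncard

end HeisenbergHodge

end

/-!
The raising operator applied to the Gaussian ground state of the harmonic oscillator `-X² - Y²`
gives the Hermite basis, on which `Δ⁽⁰⁾ = -X² - Y² - T²` acts by `α_n`. On 1-forms the Laplace
operator is the orthogonal sum of `d δ` and `(⋆ d)²`. The differentials of the Hermite functions
are exact eigenforms with eigenvalues `α_n`, while the first order operator `⋆ d` is diagonal on
coclosed forms: a function `f` with `Δ⁽⁰⁾ f = α_n f` yields one eigenform for each root `μ` of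
`μ² + μ = α_n`, and `μ² = β_n^±`. The form vanishes for `n = 0` and `μ = |k|`, and is replaced by
an eigenform with `μ = -|k|` built from the ground state. These forms are an orthogonal basis, so
that each closed operator is diagonal in an orthonormal basis and its spectrum and multiplicities
can be read off the eigenvalues, which tend to infinity. The Hodge star reduces the degrees 2 and
3 to 1 and 0.
-/

noncomputable section

namespace HeisenbergHodge

open Heisenberg

/-! ## Diagonal operators -/

section OrthogonalBasis

variable {ι K K' : Type*} [NormedAddCommGroup K] [InnerProductSpace ℂ K]
  [NormedAddCommGroup K'] [InnerProductSpace ℂ K']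

/-- An orthogonal family of nonzero vectors whose span is dense. Density is encoded by the
vanishing of every vector orthogonal to the family. -/
structure IsOrthogonalBasis (v : ι → K) : Prop where
  ne_zero : ∀ j, v j ≠ 0
  orthogonal : Pairwise fun i j => inner ℂ (v i) (v j) = 0
  total : ∀ x, (∀ j, inner ℂ (v j) x = 0) → x = 0

variable {v : ι → K}

theorem IsOrthogonalBasis.map_linearIsometryEquiv (hv : IsOrthogonalBasis v) (e : K ≃ₗᵢ[ℂ] K') :
    IsOrthogonalBasis (e ∘ v) where
  ne_zero j := by simpa using hv.ne_zero j
  orthogonal i j hij := by simpa using hv.orthogonal hij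
  total x hx := e.symm.map_eq_zero_iff.1 <| hv.total _ fun j => by
    rw [← e.inner_map_map, e.apply_symm_apply]
    exact hx j

theorem IsOrthogonalBasis.exists_hilbertBasis [CompleteSpace K] (hv : IsOrthogonalBasis v) :
    ∃ b : HilbertBasis ι ℂ K, ∀ j, b j = (‖v j‖ : ℂ)⁻¹ • v j := by
  have horth : Orthonormal ℂ fun j => (‖v j‖ : ℂ)⁻¹ • v j := by
    refine ⟨fun j => ?_, fun i j hij => ?_⟩
    · simp [norm_smul, hv.ne_zero j]
    · simp [inner_smul_left, inner_smul_right, hv.orthogonal hij]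
  have htotal : (Submodule.span ℂ (Set.range fun j => (‖v j‖ : ℂ)⁻¹ • v j))ᗮ = ⊥ := by
    refine (Submodule.eq_bot_iff _).2 fun x hx => hv.total x fun j => ?_
    have hxj := Submodule.inner_right_of_mem_orthogonal
      (Submodule.subset_span (Set.mem_range_self j)) hx
    simpa [inner_smul_left, hv.ne_zero j] using hxj
  exact ⟨.mkOfOrthogonalEqBot horth htotal, fun j => by rw [HilbertBasis.coe_mkOfOrthogonalEqBot]⟩

end OrthogonalBasis

section Diagonal

variable {ι K : Type*} [NormedAddCommGroup K] [InnerProductSpace ℂ K]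

theorem exists_continuousLinearMap_repr_eq_mul (b : HilbertBasis ι ℂ K) {m : ι → ℂ} {C : ℝ}
    (hC : 0 ≤ C) (hm : ∀ j, ‖m j‖ ≤ C) :
    ∃ R : K →L[ℂ] K, ∀ y j, b.repr (R y) j = m j * b.repr y j :=
  let M := lp.mapCLM 2 (fun j => ContinuousLinearMap.mul ℂ ℂ (m j)) hC fun j => by simpa using hm j
  ⟨b.repr.symm.toContinuousLinearEquiv.toContinuousLinearMap ∘L M ∘L
    b.repr.toContinuousLinearEquiv.toContinuousLinearMap, fun y j => by
      simp [M, lp.mapCLM]⟩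

/-- The operator `S` is symmetric, and its domain contains the Hilbert basis `b`, which
consists of eigenvectors with eigenvalues `l`. -/
structure IsDiagonal (S : K →ₗ.[ℂ] K) (b : HilbertBasis ι ℂ K) (l : ι → ℝ) : Prop where
  eigen : ∀ j, (b j, (l j : ℂ) • b j) ∈ S.graph
  symm : S.IsFormalAdjoint S

variable {S : K →ₗ.[ℂ] K} {b : HilbertBasis ι ℂ K} {l : ι → ℝ}

namespace IsDiagonal

theorem repr_apply (H : IsDiagonal S b l) (u : S.domain) (j : ι) :
    b.repr (S u) j = l j * b.repr (u : K) j := by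
  obtain ⟨w, hw, hSw⟩ := (LinearPMap.mem_graph_iff S).1 (H.eigen j)
  have hsymm := H.symm w u
  simp only at hw hSw
  rw [hw, hSw, inner_smul_left, Complex.conj_ofReal] at hsymm
  rw [b.repr_apply_apply, b.repr_apply_apply, hsymm]

theorem mem_topologicalClosure_graph_iff (H : IsDiagonal S b l) {x y : K} :
    (x, y) ∈ S.graph.topologicalClosure ↔ ∀ j, b.repr y j = l j * b.repr x j := by
  constructor
  · intro hxy j
    have hclosed : IsClosed {p : K × K | b.repr p.2 j = l j * b.repr p.1 j} := by
      simp only [b.repr_apply_apply]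
      exact isClosed_eq (by fun_prop) (by fun_prop)
    refine closure_minimal ?_ hclosed hxy
    rintro ⟨x', y'⟩ hxy'
    obtain ⟨u, rfl, rfl⟩ := (LinearPMap.mem_graph_iff S).1 hxy'
    exact H.repr_apply u j
  · intro hxy
    refine mem_closure_of_tendsto ((b.hasSum_repr x).prodMk (b.hasSum_repr y))
      (.of_forall fun s => Submodule.sum_mem _ fun j _ => ?_)
    rw [hxy j, mul_comm, mul_smul]
    exact S.graph.smul_mem (b.repr x j) (H.eigen j)

theorem isClosable (H : IsDiagonal S b l) : S.IsClosable := by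
  refine ⟨S.graph.topologicalClosure.toLinearPMap,
    (Submodule.toLinearPMap_graph_eq _ ?_).symm⟩
  rintro ⟨x, y⟩ hxy (rfl : x = 0)
  refine b.repr.map_eq_zero_iff.1 (lp.ext (funext fun j => ?_))
  simpa using H.mem_topologicalClosure_graph_iff.1 hxy j

theorem mem_graph_closure_iff (H : IsDiagonal S b l) {x y : K} :
    (x, y) ∈ S.closure.graph ↔ ∀ j, b.repr y j = l j * b.repr x j := by
  rw [← H.isClosable.graph_closure_eq_closure_graph, H.mem_topologicalClosure_graph_iff]

theorem repr_closure_apply (H : IsDiagonal S b l) (u : S.closure.domain) (j : ι) :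
    b.repr (S.closure u) j = l j * b.repr (u : K) j :=
  H.mem_graph_closure_iff.1 (LinearPMap.mem_graph _ u) j

theorem inResolventSet_of_le_norm_sub (H : IsDiagonal S b l) {z : ℂ} {ε : ℝ} (hε : 0 < ε)
    (hz : ∀ j, ε ≤ ‖(l j : ℂ) - z‖) : InResolventSet S.closure z := by
  have hne : ∀ j, (l j : ℂ) - z ≠ 0 := fun j => norm_pos_iff.1 (hε.trans_le (hz j))
  obtain ⟨R, hR⟩ := exists_continuousLinearMap_repr_eq_mul b (m := fun j => ((l j : ℂ) - z)⁻¹)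
    (inv_nonneg.2 hε.le) fun j => by rw [norm_inv]; exact inv_anti₀ hε (hz j)
  refine ⟨R, fun y => ?_, fun u => b.repr.injective (lp.ext (funext fun j => ?_))⟩
  · have hgraph : (R y, y + z • R y) ∈ S.closure.graph := by
      refine H.mem_graph_closure_iff.2 fun j => ?_
      simp only [map_add, map_smul, lp.coeFn_add, lp.coeFn_smul, Pi.add_apply, Pi.smul_apply,
        smul_eq_mul, hR]
      field_simp [hne j]
      ring
    obtain ⟨u, hu, hSu⟩ := (LinearPMap.mem_graph_iff _).1 hgraph
    obtain ⟨u, hdom⟩ := u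
    obtain rfl : u = R y := hu
    exact ⟨hdom, by rw [hSu]; simp⟩
  · simp only [hR, map_sub, map_smul, lp.coeFn_sub, lp.coeFn_smul, Pi.sub_apply, Pi.smul_apply,
      smul_eq_mul, H.repr_closure_apply]
    field_simp [hne j]

theorem not_inResolventSet_of_mem_closure (H : IsDiagonal S b l) {z : ℂ}
    (hz : z ∈ closure (Set.range fun j => (l j : ℂ))) : ¬ InResolventSet S.closure z := by
  rintro ⟨R, -, hR⟩
  have hlower : ∀ j, 1 ≤ ‖R‖ * ‖(l j : ℂ) - z‖ := fun j => by
    obtain ⟨u, hu, hSu⟩ := (LinearPMap.mem_graph_iff _).1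
      (LinearPMap.le_graph_of_le S.le_closure (H.eigen j))
    simp only at hu hSu
    have hbj : R (((l j : ℂ) - z) • b j) = b j := by rw [sub_smul, ← hSu, ← hu, hR]
    calc 1 = ‖R (((l j : ℂ) - z) • b j)‖ := by rw [hbj, b.orthonormal.1]
      _ ≤ ‖R‖ * ‖(l j : ℂ) - z‖ := by
        simpa [norm_smul, b.orthonormal.1] using R.le_opNorm (((l j : ℂ) - z) • b j)
  have hclosed : IsClosed {w : ℂ | 1 ≤ ‖R‖ * ‖w - z‖} :=
    isClosed_le continuous_const (by fun_prop)
  have hlimit : 1 ≤ ‖R‖ * ‖z - z‖ :=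
    hclosed.closure_subset_iff.2 (Set.range_subset_iff.2 hlower) hz
  norm_num at hlimit

theorem unboundedSpectrum_closure (H : IsDiagonal S b l) :
    unboundedSpectrum S.closure = closure (Set.range fun j => (l j : ℂ)) := by
  ext z
  refine ⟨fun hz => by_contra fun hzl => hz ?_, H.not_inResolventSet_of_mem_closure⟩
  rw [Metric.mem_closure_iff] at hzl
  push Not at hzl
  obtain ⟨ε, hε, hdist⟩ := hzl
  refine H.inResolventSet_of_le_norm_sub hε fun j => ?_
  rw [← dist_eq_norm, dist_comm]
  exact hdist _ ⟨j, rfl⟩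

theorem unboundedSpectrum_closure_of_tendsto (H : IsDiagonal S b l)
    (hl : Filter.Tendsto l Filter.cofinite (Filter.cocompact ℝ)) :
    unboundedSpectrum S.closure = (fun x : ℝ => (x : ℂ)) '' Set.range l := by
  let _ : TopologicalSpace ι := ⊥
  have : DiscreteTopology ι := ⟨rfl⟩
  rw [← Filter.cocompact_eq_cofinite] at hl
  have hproper : IsProperMap l :=
    isProperMap_iff_tendsto_cocompact.2 ⟨continuous_of_discreteTopology, hl⟩
  rw [H.unboundedSpectrum_closure, ← Function.comp_def, Set.range_comp]
  exact (Complex.isometry_ofReal.isClosedEmbedding.isClosedMap _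
    hproper.isClosedMap.isClosed_range).closure_eq

theorem map_eigenspace_closure (H : IsDiagonal S b l) (x : ℝ) (hx : {j | l j = x}.Finite) :
    (eigenspace S.closure x).map S.closure.domain.subtype =
      Submodule.span ℂ (b '' {j | l j = x}) := by
  apply le_antisymm
  · rintro _ ⟨u, hu, rfl⟩
    have hSu : S.closure u = (x : ℂ) • (u : K) := sub_eq_zero.1 hu
    have hrepr : ∀ j, l j ≠ x → b.repr (u : K) j = 0 := fun j hj => by
      have heq := H.repr_closure_apply u j
      rw [hSu, map_smul, lp.coeFn_smul, Pi.smul_apply, smul_eq_mul] at heq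
      by_contra hne
      exact hj (Complex.ofReal_injective (mul_right_cancel₀ hne heq).symm)
    have hsum : (u : K) = ∑ j ∈ hx.toFinset, b.repr (u : K) j • b j :=
      (b.hasSum_repr (u : K)).unique <| hasSum_sum_of_ne_finset_zero fun j hj => by
        rw [hrepr j (by simpa using hj), zero_smul]
    rw [Submodule.subtype_apply, hsum]
    exact Submodule.sum_mem _ fun j hj => Submodule.smul_mem _ _ <|
      Submodule.subset_span ⟨j, by simpa using hj, rfl⟩
  · refine Submodule.span_le.2 ?_
    rintro _ ⟨j, rfl, rfl⟩
    obtain ⟨u, hu, hSu⟩ := (LinearPMap.mem_graph_iff _).1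
      (LinearPMap.le_graph_of_le S.le_closure (H.eigen j))
    exact ⟨u, sub_eq_zero.2 (hSu.trans (congrArg ((l j : ℂ) • ·) hu.symm)), hu⟩

theorem eigenMultiplicity_closure (H : IsDiagonal S b l) (x : ℝ) (hx : {j | l j = x}.Finite) :
    eigenMultiplicity S.closure x = {j | l j = x}.ncard := by
  have := hx.fintype
  rw [eigenMultiplicity, ← Submodule.finrank_map_subtype_eq, H.map_eigenspace_closure x hx,
    Set.image_eq_range, finrank_span_eq_card, Set.ncard_eq_toFinset_card', Set.toFinset_card]
  exact b.orthonormal.linearIndependent.comp _ Subtype.val_injective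

end IsDiagonal

end Diagonal

/-! ## Smooth vectors -/

section SmoothVectors

variable (h : ℝ)

theorem orbit_mul (g g' : Heisenberg) (u : L2R) :
    orbit h u (g * g') = schrodinger h g (orbit h u g') := by
  simp [orbit, map_mul]

@[simp] theorem orbit_one (u : L2R) : orbit h u 1 = u := by
  simp [orbit]

/-- The map from vectors to their orbit maps `g ↦ ρ_h(g) u`. -/
def orbitLinearMap : L2R →ₗ[ℂ] Heisenberg → L2R where
  toFun := orbit h
  map_add' u v := by ext1 g; exact map_add (schrodinger h g) u v
  map_smul' c u := by ext1 g; exact map_smul (schrodinger h g) c u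

/-- The smooth vectors of `ρ_h`. -/
def smoothSubspace : Submodule ℂ L2R := (SmoothFun L2R).comap (orbitLinearMap h)

variable {h}

theorem mem_smoothSubspace {u : L2R} :
    u ∈ smoothSubspace h ↔ ContDiff ℝ ∞ (orbit h u ∘ ofCoord) := Iff.rfl

variable (h)

/-- The orbit map of a smooth vector as a smooth function. -/
def smoothOrbit : smoothSubspace h →ₗ[ℂ] SmoothFun L2R :=
  (orbitLinearMap h).submoduleComap (SmoothFun L2R)

@[simp]
theorem coe_smoothOrbit (u : smoothSubspace h) :
    (smoothOrbit h u : Heisenberg → L2R) = orbit h (u : L2R) := rfl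

theorem ofCoord_zero : ofCoord 0 = 1 := rfl

/-- The differential in coordinates of the left translation by a point with first coordinate `a`.
It maps a tangent vector at the unit element to the value of its left invariant vector field. -/
def leftDiff (a : ℝ) : (ℝ × ℝ × ℝ) ≃L[ℝ] (ℝ × ℝ × ℝ) where
  toFun v := (v.1, v.2.1, v.2.2 + a * v.2.1)
  invFun v := (v.1, v.2.1, v.2.2 - a * v.2.1)
  map_add' v w := by ext <;> simp only [Prod.fst_add, Prod.snd_add]; ring
  map_smul' c v := by
    ext <;> simp only [Prod.smul_fst, Prod.smul_snd, smul_eq_mul, Real.ringHom_apply]; ring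
  left_inv v := by simp
  right_inv v := by simp
  continuous_toFun := by fun_prop
  continuous_invFun := by fun_prop

theorem coord_mul_ofCoord (g : Heisenberg) (p : ℝ × ℝ × ℝ) :
    coord (g * ofCoord p) = coord g + leftDiff g.a p := by
  simp [leftDiff, coord, ofCoord, mul_def, add_assoc]

variable {h}

theorem hasFDerivAt_orbit_coord {u : L2R} {D : (ℝ × ℝ × ℝ) →L[ℝ] L2R}
    (hu : HasFDerivAt (orbit h u ∘ ofCoord) D 0) (g : Heisenberg) :
    HasFDerivAt (orbit h u ∘ ofCoord)
      (((schrodinger h g).toContinuousLinearEquiv.toContinuousLinearMap.restrictScalars ℝ ∘L D) ∘L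
        (leftDiff g.a).symm.toContinuousLinearMap) (coord g) := by
  have htranslate (p : ℝ × ℝ × ℝ) : schrodinger h g
      ((orbit h u ∘ ofCoord) ((leftDiff g.a).symm (p - coord g))) = orbit h u (ofCoord p) := by
    have hp : g * ofCoord ((leftDiff g.a).symm (p - coord g)) = ofCoord p := by
      change ofCoord (coord (g * ofCoord ((leftDiff g.a).symm (p - coord g)))) = ofCoord p
      simp only [coord_mul_ofCoord, ContinuousLinearEquiv.apply_symm_apply,
        add_sub_cancel]
    rw [Function.comp_apply, ← orbit_mul, hp]
  have hshift : HasFDerivAt (fun p => (leftDiff g.a).symm (p - coord g))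
      (leftDiff g.a).symm.toContinuousLinearMap (coord g) :=
    (leftDiff g.a).symm.hasFDerivAt.comp (coord g) ((hasFDerivAt_id _).sub_const _)
  have hu' : HasFDerivAt (orbit h u ∘ ofCoord) D ((leftDiff g.a).symm (coord g - coord g)) := by
    rwa [sub_self, map_zero]
  have hderiv := ((schrodinger h g).toContinuousLinearEquiv.toContinuousLinearMap.restrictScalars
    ℝ).hasFDerivAt.comp (coord g) (hu'.comp (coord g) hshift)
  exact hderiv.congr_of_eventuallyEq (.of_forall fun p => (htranslate p).symm)

theorem hasFDerivAt_orbit_zero (u : smoothSubspace h) :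
    HasFDerivAt (orbit h (u : L2R) ∘ ofCoord) (fderiv ℝ (orbit h (u : L2R) ∘ ofCoord) 0) 0 :=
  (smoothFun_differentiableAt (smoothOrbit h u) 0).hasFDerivAt

theorem leftField_orbit (v : ℝ × ℝ × ℝ) (u : smoothSubspace h) (g : Heisenberg) :
    (leftField L2R v (smoothOrbit h u)).1 g =
      schrodinger h g (fderiv ℝ (orbit h (u : L2R) ∘ ofCoord) 0 v) := by
  change fderiv ℝ (orbit h (u : L2R) ∘ ofCoord) (coord g) (leftDiff g.a v) = _
  rw [(hasFDerivAt_orbit_coord (hasFDerivAt_orbit_zero u) g).fderiv]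
  simp

variable (h)

/-- The operator `dρ_h(v)` on smooth vectors, for the left invariant vector field with value `v`
at the unit element: the derivative of the orbit maps at the unit element in the direction `v`. -/
def opField (v : ℝ × ℝ × ℝ) : Module.End ℂ (smoothSubspace h) :=
  (evalOne ∘ₗ leftField L2R v ∘ₗ smoothOrbit h).codRestrict _ fun u => by
    have horbit : orbit h (evalOne (leftField L2R v (smoothOrbit h u))) =
        (leftField L2R v (smoothOrbit h u)).1 := by
      funext g
      change schrodinger h g ((leftField L2R v (smoothOrbit h u)).1 1) = _
      rw [leftField_orbit, leftField_orbit, map_one]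
      rfl
    change orbit h (evalOne (leftField L2R v (smoothOrbit h u))) ∈ SmoothFun L2R
    rw [horbit]
    exact (leftField L2R v (smoothOrbit h u)).2

variable {h}

theorem coe_opField (v : ℝ × ℝ × ℝ) (u : smoothSubspace h) :
    (opField h v u : L2R) = fderiv ℝ (orbit h (u : L2R) ∘ ofCoord) 0 v := by
  change (leftField L2R v (smoothOrbit h u)).1 1 = _
  rw [leftField_orbit, map_one]
  rfl

theorem leftField_smoothOrbit (v : ℝ × ℝ × ℝ) (u : smoothSubspace h) :
    leftField L2R v (smoothOrbit h u) = smoothOrbit h (opField h v u) :=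
  Subtype.ext <| funext fun g => by
    rw [leftField_orbit, ← coe_opField]
    rfl

theorem inner_opField_left (v : ℝ × ℝ × ℝ) (u w : smoothSubspace h) :
    inner ℂ (opField h v u : L2R) (w : L2R) = -inner ℂ (u : L2R) (opField h v w : L2R) := by
  have hconst : (fun p => inner ℂ (orbit h (u : L2R) (ofCoord p)) (orbit h (w : L2R) (ofCoord p)))
      = fun _ => inner ℂ (u : L2R) (w : L2R) :=
    funext fun p => (schrodinger h (ofCoord p)).inner_map_map _ _
  have hderiv := (hasFDerivAt_orbit_zero u).inner ℂ (hasFDerivAt_orbit_zero w)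
  simp only [Function.comp_apply] at hderiv
  rw [hconst] at hderiv
  have hzero := DFunLike.congr_fun (hderiv.unique (hasFDerivAt_const _ _)) v
  simp only [ContinuousLinearMap.comp_apply, ContinuousLinearMap.prod_apply,
    fderivInnerCLM_apply, ← coe_opField, ofCoord_zero, orbit_one, zero_apply] at hzero
  exact eq_neg_of_add_eq_zero_right hzero

variable (h)

/-- The scalar `2 π i h` by which the central vector field `T` acts under `ρ_h`. -/
def centralScalar : ℂ := (2 * Real.pi * h : ℝ) * Complex.I

theorem schrodinger_central (t : ℝ) (u : L2R) :
    schrodinger h ⟨0, 0, t⟩ u = Complex.exp (t * centralScalar h) • u := by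
  refine Lp.ext ((coeFn_schrodingerOp h ⟨0, 0, t⟩ u).trans
    (Filter.EventuallyEq.trans (.of_forall fun x => ?_) (Lp.coeFn_smul _ _).symm))
  simp only [schrodingerFun, phase, centralScalar, Pi.smul_apply, smul_eq_mul, mul_zero, add_zero,
    zero_mul]
  congr 2
  push_cast
  ring

theorem hasDerivAt_exp_mul_centralScalar :
    HasDerivAt (fun t : ℝ => Complex.exp (t * centralScalar h)) (centralScalar h) 0 := by
  simpa using ((hasDerivAt_id (0 : ℝ)).ofReal_comp.mul_const (centralScalar h)).cexp

variable {h}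

theorem opField_central (u : smoothSubspace h) :
    opField h (0, 0, 1) u = centralScalar h • u := by
  have hline : HasDerivAt (fun t : ℝ => ((0, 0, t) : ℝ × ℝ × ℝ)) (0, 0, 1) 0 :=
    (hasDerivAt_const _ _).prodMk ((hasDerivAt_const _ _).prodMk (hasDerivAt_id _))
  have horbit : HasDerivAt (fun t : ℝ => orbit h (u : L2R) (ofCoord (0, 0, t)))
      (opField h (0, 0, 1) u : L2R) 0 := by
    rw [coe_opField]
    exact (smoothFun_differentiableAt (smoothOrbit h u) 0).hasFDerivAt.comp_hasDerivAt
      (f := fun t : ℝ => ((0, 0, t) : ℝ × ℝ × ℝ)) (0 : ℝ) hline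
  have hcentral : (fun t : ℝ => orbit h (u : L2R) (ofCoord (0, 0, t))) =
      fun t : ℝ => Complex.exp (t * centralScalar h) • (u : L2R) :=
    funext fun t => schrodinger_central h t u
  rw [hcentral] at horbit
  exact Subtype.ext <|
    horbit.unique ((hasDerivAt_exp_mul_centralScalar h).smul_const (u : L2R))

end SmoothVectors

/-! ## Matrices of operators -/

section MatrixAction

variable {R W W' : Type*} [Semiring R] [AddCommMonoid W] [Module R W] [AddCommMonoid W']
  [Module R W'] {l m n : Type*} [Fintype m] [Fintype n]

/-- The action of a matrix of operators on tuples of vectors. -/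
def matrixAct (Q : Matrix l n (Module.End R W)) : (n → W) →ₗ[R] (l → W) :=
  LinearMap.pi fun i => ∑ j, Q i j ∘ₗ LinearMap.proj j

theorem matrixAct_apply (Q : Matrix l n (Module.End R W)) (u : n → W) (i : l) :
    matrixAct Q u i = ∑ j, Q i j (u j) := by
  simp [matrixAct]

theorem matrixAct_add (P Q : Matrix l n (Module.End R W)) :
    matrixAct (P + Q) = matrixAct P + matrixAct Q := by
  ext1 u
  funext i
  simp [matrixAct_apply, Finset.sum_add_distrib]

theorem matrixAct_mul (P : Matrix l m (Module.End R W)) (Q : Matrix m n (Module.End R W)) :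
    matrixAct (P * Q) = matrixAct P ∘ₗ matrixAct Q := by
  ext1 u
  funext i
  simp only [LinearMap.comp_apply, matrixAct_apply, Matrix.mul_apply, LinearMap.sum_apply,
    map_sum, Module.End.mul_apply]
  exact Finset.sum_comm

/-- The map `φ` intertwines the entries of the matrix `Q` of operators on its source with the
entries of the matrix `P` of operators on its target. -/
def Intertwines (φ : W →ₗ[R] W') (Q : Matrix l n (Module.End R W))
    (P : Matrix l n (Module.End R W')) : Prop :=
  ∀ i j u, P i j (φ u) = φ (Q i j u)

variable {φ : W →ₗ[R] W'}

omit [Fintype n] in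
theorem Intertwines.add {Q Q' : Matrix l n (Module.End R W)} {P P' : Matrix l n (Module.End R W')}
    (hP : Intertwines φ Q P) (hP' : Intertwines φ Q' P') : Intertwines φ (Q + Q') (P + P') :=
  fun i j u => by
    simp only [Matrix.add_apply, LinearMap.add_apply, hP i j u, hP' i j u, map_add]

omit [Fintype n] in
theorem Intertwines.mul {Q : Matrix l m (Module.End R W)} {P : Matrix l m (Module.End R W')}
    {Q' : Matrix m n (Module.End R W)} {P' : Matrix m n (Module.End R W')}
    (hP : Intertwines φ Q P) (hP' : Intertwines φ Q' P') : Intertwines φ (Q * Q') (P * P') :=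
  fun i j u => by
    simp only [Matrix.mul_apply, LinearMap.sum_apply, Module.End.mul_apply, map_sum]
    exact Finset.sum_congr rfl fun s _ => by rw [hP' s j u, hP i s]

end MatrixAction

section MatrixAdjoint

variable {E : Type*} [NormedAddCommGroup E] [InnerProductSpace ℂ E]

/-- A skew-symmetric operator, such as the derivative of a one-parameter unitary group. -/
def IsSkewSymmetric (x : Module.End ℂ E) : Prop :=
  ∀ u w, inner ℂ (x u) w = -inner ℂ u (x w)

variable {l m n : Type*}

/-- The matrix `Q'` of operators is the formal adjoint of the matrix `Q`. -/
def IsMatrixAdjoint (Q : Matrix m n (Module.End ℂ E)) (Q' : Matrix n m (Module.End ℂ E)) : Prop :=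
  ∀ i j u w, inner ℂ (Q' j i w) u = inner ℂ w (Q i j u)

theorem IsMatrixAdjoint.symm {Q : Matrix m n (Module.End ℂ E)} {Q' : Matrix n m (Module.End ℂ E)}
    (hQ : IsMatrixAdjoint Q Q') : IsMatrixAdjoint Q' Q := fun i j u w => by
  rw [← inner_conj_symm, ← hQ, inner_conj_symm]

theorem IsMatrixAdjoint.add {P Q : Matrix m n (Module.End ℂ E)}
    {P' Q' : Matrix n m (Module.End ℂ E)} (hP : IsMatrixAdjoint P P')
    (hQ : IsMatrixAdjoint Q Q') : IsMatrixAdjoint (P + Q) (P' + Q') := fun i j u w => by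
  simp only [Matrix.add_apply, LinearMap.add_apply, inner_add_left, inner_add_right, hP i j u w,
    hQ i j u w]

theorem IsMatrixAdjoint.mul [Fintype m] {P : Matrix l m (Module.End ℂ E)}
    {P' : Matrix m l (Module.End ℂ E)} {Q : Matrix m n (Module.End ℂ E)}
    {Q' : Matrix n m (Module.End ℂ E)} (hP : IsMatrixAdjoint P P') (hQ : IsMatrixAdjoint Q Q') :
    IsMatrixAdjoint (P * Q) (Q' * P') := fun i j u w => by
  simp only [Matrix.mul_apply, LinearMap.sum_apply, Module.End.mul_apply, inner_sum, sum_inner]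
  exact Finset.sum_congr rfl fun s _ => by rw [hQ s j, hP i s]

variable {S : Submodule ℂ E}

/-- Tuples of vectors of a subspace as elements of the Hilbert sum of copies of the ambient
space. -/
def toForms : (n → S) →ₗ[ℂ] PiLp 2 (fun _ : n => E) :=
  (WithLp.linearEquiv 2 ℂ (n → E)).symm.toLinearMap ∘ₗ
    LinearMap.pi fun i => S.subtype ∘ₗ LinearMap.proj i

@[simp] theorem toForms_apply (u : n → S) (i : n) : toForms u i = (u i : E) := rfl

theorem toForms_injective : Function.Injective (toForms : (n → S) →ₗ[ℂ] _) := fun _ _ huw =>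
  funext fun i => Subtype.ext (congrArg (fun x : PiLp 2 (fun _ : n => E) => x i) huw)

variable [Fintype m] [Fintype n]

theorem inner_toForms_left (u : n → S) (x : PiLp 2 (fun _ : n => E)) :
    inner ℂ (toForms u) x = ∑ i, inner ℂ (u i : E) (x i) := rfl

theorem IsMatrixAdjoint.inner_matrixAct {Q : Matrix m n (Module.End ℂ S)}
    {Q' : Matrix n m (Module.End ℂ S)} (hQ : IsMatrixAdjoint Q Q') (w : m → S) (u : n → S) :
    inner ℂ (toForms (matrixAct Q' w)) (toForms u) =
      inner ℂ (toForms w) (toForms (matrixAct Q u)) := by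
  simp only [inner_toForms_left, toForms_apply, matrixAct_apply, Submodule.coe_sum, inner_sum,
    sum_inner]
  rw [Finset.sum_comm]
  exact Finset.sum_congr rfl fun i _ => Finset.sum_congr rfl fun j _ => hQ i j (u j) (w i)

theorem IsMatrixAdjoint.inner_eq_zero_of_ne {Q : Matrix n n (Module.End ℂ S)}
    (hQ : IsMatrixAdjoint Q Q) {u w : n → S} {r s : ℝ} (hu : matrixAct Q u = (r : ℂ) • u)
    (hw : matrixAct Q w = (s : ℂ) • w) (hrs : r ≠ s) : inner ℂ (toForms u) (toForms w) = 0 := by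
  have hinner := hQ.inner_matrixAct u w
  rw [hu, hw, map_smul, map_smul, inner_smul_left, inner_smul_right, Complex.conj_ofReal] at hinner
  by_contra hne
  exact hrs (Complex.ofReal_injective (mul_right_cancel₀ hne hinner))

end MatrixAdjoint

section LocaliseSmooth

variable {h : ℝ} {n : ℕ} {P : Matrix (Fin n) (Fin n) (Module.End ℂ (SmoothFun L2R))}
  {Q : Matrix (Fin n) (Fin n) (Module.End ℂ (smoothSubspace h))}

/-- The components of an element of the domain of `localiseSmooth` as a tuple of smooth vectors. -/
def smoothComponents (x : smoothVectors h n) : Fin n → smoothSubspace h := fun i => ⟨x.1 i, x.2 i⟩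

theorem toForms_smoothComponents (x : smoothVectors h n) : toForms (smoothComponents x) = x.1 := rfl

theorem localiseSmooth_apply (hP : Intertwines (smoothOrbit h) Q P)
    (x : (localiseSmooth h P).domain) :
    localiseSmooth h P x = toForms (matrixAct Q (smoothComponents x)) := by
  refine PiLp.ext fun i => ?_
  change evalOne ((∑ j, P i j ∘ₗ LinearMap.proj j) fun j =>
    smoothOrbit h (smoothComponents x j)) = _
  simp only [LinearMap.sum_apply, LinearMap.comp_apply, LinearMap.proj_apply, map_sum, hP i _ _,
    toForms_apply, matrixAct_apply, Submodule.coe_sum]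
  exact Finset.sum_congr rfl fun j _ => orbit_one h _

theorem isFormalAdjoint_localiseSmooth (hP : Intertwines (smoothOrbit h) Q P)
    (hQ : IsMatrixAdjoint Q Q) : (localiseSmooth h P).IsFormalAdjoint (localiseSmooth h P) :=
  fun x y => by
    rw [localiseSmooth_apply hP, localiseSmooth_apply hP, ← toForms_smoothComponents x,
      ← toForms_smoothComponents y]
    exact hQ.inner_matrixAct (smoothComponents x) (smoothComponents y)

theorem exists_isDiagonal_localiseSmooth {ι : Type*} {v : ι → Fin n → smoothSubspace h} {r : ι → ℝ}
    (hP : Intertwines (smoothOrbit h) Q P) (hQ : IsMatrixAdjoint Q Q)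
    (hv : IsOrthogonalBasis fun j => toForms (v j))
    (heigen : ∀ j, matrixAct Q (v j) = (r j : ℂ) • v j) :
    ∃ b : HilbertBasis ι ℂ (L2Forms n), IsDiagonal (localiseSmooth h P) b r := by
  obtain ⟨b, hb⟩ := hv.exists_hilbertBasis
  refine ⟨b, fun j => ?_, isFormalAdjoint_localiseSmooth hP hQ⟩
  have hmem : (toForms (v j), (r j : ℂ) • toForms (v j)) ∈ (localiseSmooth h P).graph := by
    refine (LinearPMap.mem_graph_iff _).2 ⟨⟨toForms (v j), fun i => (v j i).2⟩, rfl, ?_⟩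
    rw [localiseSmooth_apply hP, ← map_smul, ← heigen]
    rfl
  rw [hb, smul_comm]
  exact (localiseSmooth h P).graph.smul_mem _ hmem

end LocaliseSmooth

/-! ## The matrices of the Hodge Laplacians -/

section HodgeMatrices

variable {R : Type*} [Ring R] (x y t : R)

/-- The matrix of the gradient in the left invariant coframe, for elements `x`, `y`, `t` of a ring
in the roles of the left invariant vector fields `X`, `Y`, `T`. -/
def gradMatrix : Matrix (Fin 3) (Fin 1) R := !![x; y; t]

/-- The matrix of the exterior derivative from 1-forms to 2-forms. -/
def extMatrix1 : Matrix (Fin 3) (Fin 3) R := !![-y, x, -1; -t, 0, x; 0, -t, y]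

/-- The matrix of the exterior derivative from 2-forms to 3-forms. -/
def extMatrix2 : Matrix (Fin 1) (Fin 3) R := !![t, -y, x]

/-- The matrix of the codifferential on 1-forms. -/
def codiffMatrix : Matrix (Fin 1) (Fin 3) R := !![-x, -y, -t]

/-- The matrix of the first order operator `⋆ d` on 1-forms. -/
def curlMatrix : Matrix (Fin 3) (Fin 3) R := !![0, -t, y; t, 0, -x; -y, x, -1]

variable (R) in
/-- The matrix of the Hodge star between 1-forms and 2-forms. -/
def starMatrix : Matrix (Fin 3) (Fin 3) R := !![0, 0, 1; 0, -1, 0; 1, 0, 0]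

/-- The Hodge Laplace operator on functions. -/
def lapMatrix0 : Matrix (Fin 1) (Fin 1) R := codiffMatrix x y t * gradMatrix x y t

/-- The Hodge Laplace operator on 1-forms. As `δ = ⋆ d ⋆` on 2-forms, the summand `δ d` is the
square of `⋆ d`. -/
def lapMatrix1 : Matrix (Fin 3) (Fin 3) R :=
  gradMatrix x y t * codiffMatrix x y t + curlMatrix x y t * curlMatrix x y t

variable (R) in
theorem starMatrix_mul_self : starMatrix R * starMatrix R = 1 := by
  ext i j
  fin_cases i <;> fin_cases j <;> simp [starMatrix, Matrix.mul_apply, Fin.sum_univ_three]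

theorem starMatrix_mul_extMatrix1 : starMatrix R * extMatrix1 x y t = curlMatrix x y t := by
  ext i j
  fin_cases i <;> fin_cases j <;>
    simp [starMatrix, extMatrix1, curlMatrix, Matrix.mul_apply, Fin.sum_univ_three]

theorem neg_extMatrix2_mul_starMatrix :
    -(extMatrix2 x y t * starMatrix R) = codiffMatrix x y t := by
  ext i j
  fin_cases i
  fin_cases j <;> simp [starMatrix, extMatrix2, codiffMatrix]

theorem extMatrix2_mul_neg_starMatrix_mul_gradMatrix :
    extMatrix2 x y t * -(starMatrix R * gradMatrix x y t) = lapMatrix0 x y t := by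
  rw [lapMatrix0, ← neg_extMatrix2_mul_starMatrix, Matrix.mul_neg, Matrix.neg_mul,
    Matrix.mul_assoc]

theorem starMatrix_mul_lapMatrix1_mul_starMatrix :
    starMatrix R * lapMatrix1 x y t * starMatrix R =
      extMatrix1 x y t * (curlMatrix x y t * starMatrix R) +
        -(starMatrix R * gradMatrix x y t) * extMatrix2 x y t := by
  have hstar (M : Matrix (Fin 3) (Fin 3) R) : starMatrix R * (starMatrix R * M) = M := by
    rw [← Matrix.mul_assoc, starMatrix_mul_self, Matrix.one_mul]
  rw [lapMatrix1, ← neg_extMatrix2_mul_starMatrix, ← starMatrix_mul_extMatrix1]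
  simp only [Matrix.mul_add, Matrix.add_mul, Matrix.mul_neg, Matrix.neg_mul, Matrix.mul_assoc,
    hstar, starMatrix_mul_self, Matrix.mul_one]
  rw [add_comm]

variable {x y t}

theorem curlMatrix_mul_gradMatrix (hxy : x * y - y * x = t) (hxt : Commute x t)
    (hyt : Commute y t) : curlMatrix x y t * gradMatrix x y t = 0 := by
  ext i j
  fin_cases j
  fin_cases i
  · simp [curlMatrix, gradMatrix, Matrix.mul_apply, Fin.sum_univ_three, hyt.eq]
  · simp [curlMatrix, gradMatrix, Matrix.mul_apply, Fin.sum_univ_three, hxt.eq]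
  · simp [curlMatrix, gradMatrix, Matrix.mul_apply, Fin.sum_univ_three, ← hxy]

theorem codiffMatrix_mul_curlMatrix (hxy : x * y - y * x = t) (hxt : Commute x t)
    (hyt : Commute y t) : codiffMatrix x y t * curlMatrix x y t = 0 := by
  ext i j
  fin_cases i
  fin_cases j
  · simp [curlMatrix, codiffMatrix, Matrix.mul_apply, Fin.sum_univ_three, hyt.eq]
  · simp [curlMatrix, codiffMatrix, Matrix.mul_apply, Fin.sum_univ_three, hxt.eq]
  · simp [curlMatrix, codiffMatrix, Matrix.mul_apply, Fin.sum_univ_three, ← hxy]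

variable (E : Type*) [NormedAddCommGroup E] [NormedSpace ℂ E]

theorem extD0_eq : extD0 E = gradMatrix (fieldX E) (fieldY E) (fieldT E) := rfl

theorem extD1_eq : extD1 E = extMatrix1 (fieldX E) (fieldY E) (fieldT E) := rfl

theorem extD2_eq : extD2 E = extMatrix2 (fieldX E) (fieldY E) (fieldT E) := rfl

theorem hodgeStar_eq : hodgeStar E = starMatrix (Module.End ℂ (SmoothFun E)) := rfl

theorem codiff1_eq : codiff1 E = codiffMatrix (fieldX E) (fieldY E) (fieldT E) := by
  rw [codiff1, hodgeStarTop, extD2_eq, hodgeStar_eq, Matrix.one_mul,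
    neg_extMatrix2_mul_starMatrix]

theorem codiff2_eq :
    codiff2 E = curlMatrix (fieldX E) (fieldY E) (fieldT E) *
      starMatrix (Module.End ℂ (SmoothFun E)) := by
  rw [codiff2, extD1_eq, hodgeStar_eq, starMatrix_mul_extMatrix1]

theorem codiff3_eq :
    codiff3 E = -(starMatrix (Module.End ℂ (SmoothFun E)) *
      gradMatrix (fieldX E) (fieldY E) (fieldT E)) := by
  rw [codiff3, hodgeStarTop, extD0_eq, hodgeStar_eq, Matrix.mul_one]

theorem hodgeLaplacian0_eq : hodgeLaplacian0 E = lapMatrix0 (fieldX E) (fieldY E) (fieldT E) := by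
  rw [hodgeLaplacian0, codiff1_eq, extD0_eq, lapMatrix0]

theorem hodgeLaplacian1_eq : hodgeLaplacian1 E = lapMatrix1 (fieldX E) (fieldY E) (fieldT E) := by
  rw [hodgeLaplacian1, codiff1_eq, codiff2_eq, extD0_eq, extD1_eq, Matrix.mul_assoc _ _
    (extMatrix1 _ _ _), starMatrix_mul_extMatrix1, lapMatrix1]

theorem hodgeLaplacian2_eq : hodgeLaplacian2 E =
    starMatrix (Module.End ℂ (SmoothFun E)) * lapMatrix1 (fieldX E) (fieldY E) (fieldT E) *
      starMatrix (Module.End ℂ (SmoothFun E)) := by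
  rw [hodgeLaplacian2, codiff2_eq, codiff3_eq, extD1_eq, extD2_eq]
  exact (starMatrix_mul_lapMatrix1_mul_starMatrix _ _ _).symm

theorem hodgeLaplacian3_eq_hodgeLaplacian0 : hodgeLaplacian3 E = hodgeLaplacian0 E := by
  rw [hodgeLaplacian3, codiff3_eq, extD2_eq, hodgeLaplacian0_eq]
  exact extMatrix2_mul_neg_starMatrix_mul_gradMatrix _ _ _

end HodgeMatrices

section HodgeIntertwines

variable {W W' : Type*} [AddCommGroup W] [Module ℂ W] [AddCommGroup W'] [Module ℂ W']
  {φ : W →ₗ[ℂ] W'} {X Y T : Module.End ℂ W} {X' Y' T' : Module.End ℂ W'}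

theorem intertwines_starMatrix : Intertwines φ (starMatrix _) (starMatrix _) := fun i j u => by
  fin_cases i <;> fin_cases j <;> simp [starMatrix]

theorem intertwines_gradMatrix (hX : ∀ u, X' (φ u) = φ (X u)) (hY : ∀ u, Y' (φ u) = φ (Y u))
    (hT : ∀ u, T' (φ u) = φ (T u)) :
    Intertwines φ (gradMatrix X Y T) (gradMatrix X' Y' T') := fun i j u => by
  fin_cases j
  fin_cases i <;> simp [gradMatrix, hX, hY, hT]

theorem intertwines_codiffMatrix (hX : ∀ u, X' (φ u) = φ (X u)) (hY : ∀ u, Y' (φ u) = φ (Y u))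
    (hT : ∀ u, T' (φ u) = φ (T u)) :
    Intertwines φ (codiffMatrix X Y T) (codiffMatrix X' Y' T') := fun i j u => by
  fin_cases i
  fin_cases j <;> simp [codiffMatrix, hX, hY, hT]

theorem intertwines_curlMatrix (hX : ∀ u, X' (φ u) = φ (X u)) (hY : ∀ u, Y' (φ u) = φ (Y u))
    (hT : ∀ u, T' (φ u) = φ (T u)) :
    Intertwines φ (curlMatrix X Y T) (curlMatrix X' Y' T') := fun i j u => by
  fin_cases i <;> fin_cases j <;> simp [curlMatrix, hX, hY, hT]

theorem intertwines_lapMatrix0 (hX : ∀ u, X' (φ u) = φ (X u)) (hY : ∀ u, Y' (φ u) = φ (Y u))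
    (hT : ∀ u, T' (φ u) = φ (T u)) :
    Intertwines φ (lapMatrix0 X Y T) (lapMatrix0 X' Y' T') :=
  (intertwines_codiffMatrix hX hY hT).mul (intertwines_gradMatrix hX hY hT)

theorem intertwines_lapMatrix1 (hX : ∀ u, X' (φ u) = φ (X u)) (hY : ∀ u, Y' (φ u) = φ (Y u))
    (hT : ∀ u, T' (φ u) = φ (T u)) :
    Intertwines φ (lapMatrix1 X Y T) (lapMatrix1 X' Y' T') :=
  ((intertwines_gradMatrix hX hY hT).mul (intertwines_codiffMatrix hX hY hT)).add
    ((intertwines_curlMatrix hX hY hT).mul (intertwines_curlMatrix hX hY hT))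

end HodgeIntertwines

section HodgeAdjoint

variable {E : Type*} [NormedAddCommGroup E] [InnerProductSpace ℂ E] {X Y T : Module.End ℂ E}

theorem isMatrixAdjoint_starMatrix :
    IsMatrixAdjoint (starMatrix (Module.End ℂ E)) (starMatrix _) := fun i j u w => by
  fin_cases i <;> fin_cases j <;> simp [starMatrix]

theorem isMatrixAdjoint_gradMatrix (hX : IsSkewSymmetric X) (hY : IsSkewSymmetric Y)
    (hT : IsSkewSymmetric T) :
    IsMatrixAdjoint (gradMatrix X Y T) (codiffMatrix X Y T) := fun i j u w => by
  fin_cases j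
  fin_cases i <;> simp [gradMatrix, codiffMatrix, hX w u, hY w u, hT w u]

theorem isMatrixAdjoint_curlMatrix (hX : IsSkewSymmetric X) (hY : IsSkewSymmetric Y)
    (hT : IsSkewSymmetric T) :
    IsMatrixAdjoint (curlMatrix X Y T) (curlMatrix X Y T) := fun i j u w => by
  fin_cases i <;> fin_cases j <;> simp [curlMatrix, hX w u, hY w u, hT w u]

theorem isMatrixAdjoint_lapMatrix0 (hX : IsSkewSymmetric X) (hY : IsSkewSymmetric Y)
    (hT : IsSkewSymmetric T) : IsMatrixAdjoint (lapMatrix0 X Y T) (lapMatrix0 X Y T) :=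
  (isMatrixAdjoint_gradMatrix hX hY hT).symm.mul (isMatrixAdjoint_gradMatrix hX hY hT)

theorem isMatrixAdjoint_lapMatrix1 (hX : IsSkewSymmetric X) (hY : IsSkewSymmetric Y)
    (hT : IsSkewSymmetric T) : IsMatrixAdjoint (lapMatrix1 X Y T) (lapMatrix1 X Y T) :=
  ((isMatrixAdjoint_gradMatrix hX hY hT).mul (isMatrixAdjoint_gradMatrix hX hY hT).symm).add
    ((isMatrixAdjoint_curlMatrix hX hY hT).mul (isMatrixAdjoint_curlMatrix hX hY hT))

variable (E) in
/-- The Hodge star between 1-forms and 2-forms with components in `E` as a unitary operator. -/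
def starIsometry : PiLp 2 (fun _ : Fin 3 => E) ≃ₗᵢ[ℂ] PiLp 2 (fun _ : Fin 3 => E) where
  toFun x := WithLp.toLp 2 ![x 2, -x 1, x 0]
  invFun x := WithLp.toLp 2 ![x 2, -x 1, x 0]
  map_add' x y := by
    ext i
    fin_cases i <;> simp [add_comm]
  map_smul' c x := by
    ext i
    fin_cases i <;> simp
  left_inv x := by
    ext i
    fin_cases i <;> simp
  right_inv x := by
    ext i
    fin_cases i <;> simp
  norm_map' x := by
    simp [PiLp.norm_eq_of_L2, Fin.sum_univ_three, add_comm, add_assoc]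

theorem toForms_matrixAct_starMatrix {S : Submodule ℂ E} (u : Fin 3 → S) :
    toForms (matrixAct (starMatrix (Module.End ℂ S)) u) = starIsometry E (toForms u) := by
  ext i
  fin_cases i <;> simp [starIsometry, starMatrix, matrixAct_apply, Fin.sum_univ_three]

end HodgeAdjoint

section Commutator

theorem fieldX_fieldY_sub {E : Type*} [NormedAddCommGroup E] [NormedSpace ℂ E] (F : SmoothFun E) :
    fieldX E (fieldY E F) - fieldY E (fieldX E F) = fieldT E F := by
  ext g
  set G : ℝ × ℝ × ℝ → E := F.1 ∘ ofCoord
  have hG : ContDiff ℝ ∞ G := F.2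
  have hG' : DifferentiableAt ℝ (fderiv ℝ G) (coord g) :=
    (hG.fderiv_right (m := ∞) (by simp)).differentiable (by simp) _
  have hfield (w : (ℝ × ℝ × ℝ) → ℝ × ℝ × ℝ) (hw : DifferentiableAt ℝ w (coord g))
      (v : ℝ × ℝ × ℝ) : fderiv ℝ (fun p => fderiv ℝ G p (w p)) (coord g) v =
        fderiv ℝ (fderiv ℝ G) (coord g) v (w (coord g)) +
          fderiv ℝ G (coord g) (fderiv ℝ w (coord g) v) := by
    simp [fderiv_clm_apply hG' hw, add_comm]
  have hsymm : IsSymmSndFDerivAt ℝ G (coord g) :=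
    hG.contDiffAt.isSymmSndFDerivAt (by simp [ENat.LEInfty.out])
  have hframe : HasFDerivAt (fun p : ℝ × ℝ × ℝ => ((0, 1, 0 + p.1 * 1) : ℝ × ℝ × ℝ))
      ((0 : (ℝ × ℝ × ℝ) →L[ℝ] ℝ).prod
        ((0 : (ℝ × ℝ × ℝ) →L[ℝ] ℝ).prod (ContinuousLinearMap.fst ℝ ℝ (ℝ × ℝ)))) (coord g) := by
    refine (hasFDerivAt_const _ _).prodMk ((hasFDerivAt_const _ _).prodMk ?_)
    simpa using hasFDerivAt_fst
  change fderiv ℝ (fun p => fderiv ℝ G p (0, 1, 0 + p.1 * 1)) (coord g) (1, 0, 0 + g.a * 0) -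
      fderiv ℝ (fun p => fderiv ℝ G p (1, 0, 0 + p.1 * 0)) (coord g) (0, 1, 0 + g.a * 1) =
    fderiv ℝ G (coord g) (0, 0, 1 + g.a * 0)
  rw [hfield _ hframe.differentiableAt, hfield _ (by fun_prop), hframe.fderiv, hsymm.eq]
  simp [coord]

variable {h : ℝ}

theorem smoothOrbit_injective : Function.Injective (smoothOrbit h) := fun u w huw =>
  Subtype.ext <| by simpa using congrFun (congrArg Subtype.val huw) 1

theorem opField_commutator (u : smoothSubspace h) :
    opField h (1, 0, 0) (opField h (0, 1, 0) u) - opField h (0, 1, 0) (opField h (1, 0, 0) u) =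
      opField h (0, 0, 1) u :=
  smoothOrbit_injective <| by
    simp only [map_sub, ← leftField_smoothOrbit]
    exact fieldX_fieldY_sub (smoothOrbit h u)

end Commutator

/-! ## Eigenforms -/

section Eigenvalues

variable (k : ℝ)

/-- The number `√(α_n + 1/4)`, so that `rootA k n - 1/2` and `-(rootA k n + 1/2)` are the two
solutions `μ` of `μ² + μ = α_n`. -/
def rootA (n : ℕ) : ℝ := √(|k| * (2 * n + 1) + k ^ 2 + 1 / 4)

theorem rootA_sq (n : ℕ) : rootA k n ^ 2 = eigA k n + 1 / 4 := by
  rw [rootA, Real.sq_sqrt (by positivity), eigA]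
  ring

theorem eigPlus_eq (n : ℕ) : eigPlus k n = (rootA k n + 1 / 2) ^ 2 := rfl

theorem eigMinus_eq (n : ℕ) : eigMinus k n = (rootA k n - 1 / 2) ^ 2 := rfl

theorem neg_rootA_add_half_quadratic (n : ℕ) :
    (-(rootA k n + 1 / 2)) ^ 2 + -(rootA k n + 1 / 2) = eigA k n := by
  linear_combination rootA_sq k n

theorem rootA_sub_half_quadratic (n : ℕ) :
    (rootA k n - 1 / 2) ^ 2 + (rootA k n - 1 / 2) = eigA k n := by
  linear_combination rootA_sq k n

theorem rootA_zero : rootA k 0 = |k| + 1 / 2 := by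
  rw [rootA, ← Real.sqrt_sq (by positivity : 0 ≤ |k| + 1 / 2)]
  congr 1
  rw [add_sq, sq_abs]
  push_cast
  ring

variable {k}

theorem eigA_strictMono (hk : k ≠ 0) : StrictMono (eigA k) := fun m n hmn => by
  have _ := abs_pos.2 hk
  unfold eigA
  gcongr

theorem rootA_strictMono (hk : k ≠ 0) : StrictMono (rootA k) := fun m n hmn => by
  have _ := abs_pos.2 hk
  refine Real.sqrt_lt_sqrt (by positivity) ?_
  gcongr

theorem abs_add_half_le_rootA (hk : k ≠ 0) (n : ℕ) : |k| + 1 / 2 ≤ rootA k n :=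
  (rootA_zero k).symm.trans_le ((rootA_strictMono hk).monotone n.zero_le)

theorem abs_add_half_lt_rootA_succ (hk : k ≠ 0) (n : ℕ) : |k| + 1 / 2 < rootA k (n + 1) :=
  (rootA_zero k).symm.trans_lt (rootA_strictMono hk n.succ_pos)

variable (k)

/-- The eigenvalues of the first order operator `⋆ d` on coclosed 1-forms. The solution
`μ = rootA k 0 - 1/2 = |k|` of `μ² + μ = α_0` does not occur; the ground state contributes `-|k|`
instead. -/
def curlValue : ℕ ⊕ ℕ → ℝ
  | .inl n => -(rootA k n + 1 / 2)
  | .inr 0 => -|k|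
  | .inr (n + 1) => rootA k (n + 1) - 1 / 2

theorem curlValue_sq (i : ℕ ⊕ ℕ) : curlValue k i ^ 2 = Sum.elim (eigPlus k) (eigMinus k) i := by
  rcases i with n | _ | n
  · exact neg_sq _
  · rw [curlValue, Sum.elim_inr, eigMinus_eq, rootA_zero, add_sub_cancel_right, neg_sq]
  · rfl

variable {k}

theorem curlValue_ne_zero (hk : k ≠ 0) (i : ℕ ⊕ ℕ) : curlValue k i ≠ 0 := by
  have hk' := abs_pos.2 hk
  rcases i with n | _ | n <;> simp only [curlValue]
  · linarith [abs_add_half_le_rootA hk n]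
  · exact (neg_neg_of_pos hk').ne
  · linarith [abs_add_half_le_rootA hk (n + 1)]

theorem curlValue_injective (hk : k ≠ 0) : Function.Injective (curlValue k) := by
  have hk' := abs_pos.2 hk
  have hle := abs_add_half_le_rootA hk
  have hlt := abs_add_half_lt_rootA_succ hk
  rintro (m | _ | m) (n | _ | n) hmn <;> simp only [curlValue] at hmn
  · exact congrArg Sum.inl ((rootA_strictMono hk).injective (by linarith))
  · linarith [hle m]
  · linarith [hle m, hlt n]
  · linarith [hle n]
  · rfl
  · linarith [hlt n]
  · linarith [hlt m, hle n]
  · linarith [hlt m]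
  · exact congrArg Sum.inr ((rootA_strictMono hk).injective (by linarith))

end Eigenvalues

section CoclosedForms

variable {W : Type*} [AddCommGroup W] [Module ℂ W] (X Y T : Module.End ℂ W)

theorem matrixAct_gradMatrix (f : W) : matrixAct (gradMatrix X Y T) ![f] = ![X f, Y f, T f] := by
  ext i
  fin_cases i <;> simp [matrixAct_apply, gradMatrix]

theorem matrixAct_curlMatrix (u v w : W) : matrixAct (curlMatrix X Y T) ![u, v, w] =
    ![-T v + Y w, T u - X w, -Y u + X v - w] := by
  ext i
  fin_cases i <;> simp [matrixAct_apply, curlMatrix, Fin.sum_univ_three, sub_eq_add_neg]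

theorem matrixAct_lapMatrix0 (f : W) :
    matrixAct (lapMatrix0 X Y T) ![f] = ![-X (X f) - Y (Y f) - T (T f)] := by
  ext i
  simp [matrixAct_apply, lapMatrix0, codiffMatrix, gradMatrix, sub_eq_add_neg, add_assoc]

theorem matrixAct_lapMatrix1 (u : Fin 3 → W) : matrixAct (lapMatrix1 X Y T) u =
    matrixAct (gradMatrix X Y T) (matrixAct (codiffMatrix X Y T) u) +
      matrixAct (curlMatrix X Y T) (matrixAct (curlMatrix X Y T) u) := by
  simp only [lapMatrix1, matrixAct_add, matrixAct_mul, LinearMap.add_apply, LinearMap.comp_apply]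

/-- A 1-form built from a function `f` with `Δ f = (μ² + μ) f`, which is an eigenvector of the
operator `⋆ d` for the eigenvalue `μ`. -/
def coclosedVector (μ : ℂ) (f : W) : Fin 3 → W :=
  matrixAct (curlMatrix X Y T) ![0, 0, f] + (1 + μ) • ![0, 0, f] +
    μ⁻¹ • matrixAct (gradMatrix X Y T) ![T f]

theorem coclosedVector_eq (μ : ℂ) (f : W) : coclosedVector X Y T μ f =
    ![Y f + μ⁻¹ • X (T f), -X f + μ⁻¹ • Y (T f), μ • f + μ⁻¹ • T (T f)] := by
  rw [coclosedVector, matrixAct_curlMatrix, matrixAct_gradMatrix]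
  ext i
  fin_cases i
  · simp
  · simp
  · simp [add_smul]

variable {X Y T}

section Commutation

variable (hXY : X * Y - Y * X = T) (hXT : Commute X T) (hYT : Commute Y T)
include hXY hXT hYT

theorem curl_grad (u : Fin 1 → W) :
    matrixAct (curlMatrix X Y T) (matrixAct (gradMatrix X Y T) u) = 0 := by
  rw [← LinearMap.comp_apply, ← matrixAct_mul, curlMatrix_mul_gradMatrix hXY hXT hYT]
  ext i
  simp [matrixAct_apply]

theorem codiff_curl (u : Fin 3 → W) :
    matrixAct (codiffMatrix X Y T) (matrixAct (curlMatrix X Y T) u) = 0 := by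
  rw [← LinearMap.comp_apply, ← matrixAct_mul, codiffMatrix_mul_curlMatrix hXY hXT hYT]
  ext i
  simp [matrixAct_apply]

theorem matrixAct_lapMatrix1_grad {α : ℂ} {u : Fin 1 → W}
    (hu : matrixAct (lapMatrix0 X Y T) u = α • u) :
    matrixAct (lapMatrix1 X Y T) (matrixAct (gradMatrix X Y T) u) =
      α • matrixAct (gradMatrix X Y T) u := by
  rw [lapMatrix0, matrixAct_mul, LinearMap.comp_apply] at hu
  rw [matrixAct_lapMatrix1, curl_grad hXY hXT hYT, hu, map_zero, add_zero, map_smul]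

theorem matrixAct_lapMatrix1_of_curl {μ : ℂ} (hμ : μ ≠ 0) {u : Fin 3 → W}
    (hu : matrixAct (curlMatrix X Y T) u = μ • u) :
    matrixAct (lapMatrix1 X Y T) u = μ ^ 2 • u := by
  have hcodiff : matrixAct (codiffMatrix X Y T) u = 0 := by
    have hcurl := codiff_curl hXY hXT hYT u
    rw [hu, map_smul] at hcurl
    exact (smul_eq_zero.1 hcurl).resolve_left hμ
  rw [matrixAct_lapMatrix1, hcodiff, map_zero, zero_add, hu, map_smul, hu, smul_smul, sq]

omit hXY in
theorem curl_curl_vertical (f : W) :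
    matrixAct (curlMatrix X Y T) (matrixAct (curlMatrix X Y T) ![0, 0, f]) =
      matrixAct (gradMatrix X Y T) ![T f] - matrixAct (curlMatrix X Y T) ![0, 0, f] +
        ![0, 0, matrixAct (lapMatrix0 X Y T) ![f] 0] := by
  have hXTf : X (T f) = T (X f) := LinearMap.congr_fun hXT.eq f
  have hYTf : Y (T f) = T (Y f) := LinearMap.congr_fun hYT.eq f
  simp only [matrixAct_curlMatrix, matrixAct_gradMatrix, matrixAct_lapMatrix0, hXTf, hYTf]
  ext i
  fin_cases i
  · simp [sub_eq_add_neg]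
  · simp
  · simp
    abel

theorem curl_coclosedVector {μ : ℂ} (hμ : μ ≠ 0) {f : W}
    (hf : matrixAct (lapMatrix0 X Y T) ![f] = (μ ^ 2 + μ) • ![f]) :
    matrixAct (curlMatrix X Y T) (coclosedVector X Y T μ f) = μ • coclosedVector X Y T μ f := by
  have hvert : ![0, 0, matrixAct (lapMatrix0 X Y T) ![f] 0] = (μ ^ 2 + μ) • ![0, 0, f] := by
    simp [hf]
  simp only [coclosedVector, map_add, map_smul, curl_curl_vertical hXT hYT,
    curl_grad hXY hXT hYT, hvert]
  simp only [smul_add, smul_inv_smul₀ hμ, smul_zero]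
  module

end Commutation

end CoclosedForms

/-! ## Ladder operators -/

section Ladder

variable {W : Type*} [AddCommGroup W] [Module ℂ W] (k : ℝ) (X Y T : Module.End ℂ W) (f₀ : W)

/-- The imaginary unit with the sign of `k`, so that `k * I = |k| * imaginarySign k`. -/
def imaginarySign : ℂ := (k / |k| : ℝ) * Complex.I

/-- The raising operator of the harmonic oscillator `-X² - Y²`. -/
def raising : Module.End ℂ W := -X - imaginarySign k • Y

/-- The lowering operator of the harmonic oscillator `-X² - Y²`. -/
def lowering : Module.End ℂ W := X - imaginarySign k • Y

/-- The eigenvectors of the harmonic oscillator `-X² - Y²` obtained from a ground state `f₀`; in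
the Schrödinger representation these are multiples of the Hermite functions. -/
def ladder (n : ℕ) : W := (raising k X Y ^ n) f₀

/-- The eigenvector of `⋆ d` for the eigenvalue `-|k|` built from the ground state. -/
def groundVector : Fin 3 → W := ![f₀, -imaginarySign k • f₀, 0]

/-- The eigenvectors of `⋆ d` on coclosed 1-forms, in the order of their eigenvalues
`curlValue`. -/
def curlVector : ℕ ⊕ ℕ → Fin 3 → W
  | .inl n => coclosedVector X Y T (curlValue k (.inl n)) (ladder k X Y f₀ n)
  | .inr 0 => groundVector k f₀
  | .inr (n + 1) => coclosedVector X Y T (curlValue k (.inr (n + 1))) (ladder k X Y f₀ (n + 1))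

/-- Eigenvectors of the Hodge Laplace operator on 1-forms: the differentials of its eigenfunctions
and the coclosed eigenvectors of `⋆ d`. -/
def formVector : ℕ ⊕ (ℕ ⊕ ℕ) → Fin 3 → W :=
  Sum.elim (fun n => matrixAct (gradMatrix X Y T) ![ladder k X Y f₀ n]) (curlVector k X Y T f₀)

/-- The eigenvalues of the eigenvectors `formVector`. -/
def formValue : ℕ ⊕ (ℕ ⊕ ℕ) → ℝ := Sum.elim (eigA k) (Sum.elim (eigPlus k) (eigMinus k))

theorem ladder_succ (n : ℕ) : ladder k X Y f₀ (n + 1) = raising k X Y (ladder k X Y f₀ n) := by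
  rw [ladder, pow_succ', Module.End.mul_apply, ladder]

variable {k}

theorem imaginarySign_mul_self (hk : k ≠ 0) : imaginarySign k * imaginarySign k = -1 := by
  have hsq : k / |k| * (k / |k|) = 1 := by
    rw [div_mul_div_comm, abs_mul_abs_self, div_self (mul_ne_zero hk hk)]
  rw [imaginarySign, mul_mul_mul_comm, Complex.I_mul_I, ← Complex.ofReal_mul, hsq,
    Complex.ofReal_one, one_mul]

theorem imaginarySign_ne_zero (hk : k ≠ 0) : imaginarySign k ≠ 0 := fun hzero => by
  simpa [hzero] using imaginarySign_mul_self hk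

theorem abs_mul_imaginarySign (hk : k ≠ 0) : ((|k| : ℝ) : ℂ) * imaginarySign k = k * Complex.I := by
  rw [imaginarySign, ← mul_assoc, ← Complex.ofReal_mul, mul_div_cancel₀ _ (abs_ne_zero.2 hk)]

theorem sq_lt_sq_curlValue_inl (hk : k ≠ 0) (n : ℕ) : k ^ 2 < curlValue k (.inl n) ^ 2 := by
  rw [curlValue, neg_sq, ← sq_abs k]
  have _ := abs_add_half_le_rootA hk n
  exact pow_lt_pow_left₀ (by linarith) (abs_nonneg k) two_ne_zero

theorem sq_lt_sq_curlValue_inr_succ (hk : k ≠ 0) (n : ℕ) :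
    k ^ 2 < curlValue k (.inr (n + 1)) ^ 2 := by
  rw [curlValue, ← sq_abs k]
  have _ := abs_add_half_lt_rootA_succ hk n
  exact pow_lt_pow_left₀ (by linarith) (abs_nonneg k) two_ne_zero

variable {X Y T}

theorem vertical_mem_of_coclosedVector_mem {K : Submodule ℂ (Fin 3 → W)} {μ ν : ℂ} {f : W}
    (hμν : μ ≠ ν) (hgrad : matrixAct (gradMatrix X Y T) ![T f] ∈ K)
    (hμ : coclosedVector X Y T μ f ∈ K) (hν : coclosedVector X Y T ν f ∈ K) :
    ![0, 0, f] ∈ K ∧ matrixAct (curlMatrix X Y T) ![0, 0, f] ∈ K := by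
  have hstrip {σ : ℂ} (hσ : coclosedVector X Y T σ f ∈ K) :
      matrixAct (curlMatrix X Y T) ![0, 0, f] + (1 + σ) • ![0, 0, f] ∈ K :=
    (K.add_mem_iff_left (K.smul_mem _ hgrad)).1 hσ
  have hvert : ![0, 0, f] ∈ K := by
    refine (K.smul_mem_iff (sub_ne_zero.2 hμν)).1 ?_
    convert K.sub_mem (hstrip hμ) (hstrip hν) using 1
    module
  exact ⟨hvert, (K.add_mem_iff_left (K.smul_mem _ hvert)).1 (hstrip hμ)⟩

end Ladder

/-- An abstract model of the Schrödinger representation of the Heisenberg Lie algebra: the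
operators `X`, `Y`, `T` act skew-symmetrically on a subspace `S` of a Hilbert space, `T = [X, Y]`
is the scalar `k * I`, and the ground state `f₀` is a cyclic vector of `Y`. -/
structure IsFockModel {E : Type*} [NormedAddCommGroup E] [InnerProductSpace ℂ E]
    {S : Submodule ℂ E} (k : ℝ) (X Y T : Module.End ℂ S) (f₀ : S) : Prop where
  ne_zero : k ≠ 0
  isSkewSymmetric_X : IsSkewSymmetric X
  isSkewSymmetric_Y : IsSkewSymmetric Y
  commutator : X * Y - Y * X = T
  central (u : S) : T u = ((k : ℂ) * Complex.I) • u
  ground_ne_zero : f₀ ≠ 0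
  lowering_ground : lowering k X Y f₀ = 0
  cyclic (x : E) : (∀ n, inner ℂ (((Y ^ n) f₀ : S) : E) x = 0) → x = 0

namespace IsFockModel

variable {E : Type*} [NormedAddCommGroup E] [InnerProductSpace ℂ E] {S : Submodule ℂ E} {k : ℝ}
  {X Y T : Module.End ℂ S} {f₀ : S} (hfock : IsFockModel k X Y T f₀)
include hfock

theorem commute_X : Commute X T := LinearMap.ext fun u => by
  simp only [Module.End.mul_apply, hfock.central, map_smul]

theorem commute_Y : Commute Y T := LinearMap.ext fun u => by
  simp only [Module.End.mul_apply, hfock.central, map_smul]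

theorem isSkewSymmetric_T : IsSkewSymmetric T := fun u w => by
  simp [hfock.central, mul_comm]

theorem X_apply_Y (u : S) : X (Y u) = Y (X u) + ((k : ℂ) * Complex.I) • u := by
  rw [← hfock.central, ← hfock.commutator, LinearMap.sub_apply, Module.End.mul_apply,
    Module.End.mul_apply, add_sub_cancel]

theorem lowering_raising (u : S) :
    lowering k X Y (raising k X Y u) = -X (X u) - Y (Y u) + ((|k| : ℝ) : ℂ) • u := by
  have hsq := imaginarySign_mul_self hfock.ne_zero
  have hk := abs_mul_imaginarySign hfock.ne_zero
  simp only [lowering, raising, LinearMap.sub_apply, LinearMap.neg_apply, LinearMap.smul_apply,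
    map_sub, map_neg, map_smul, hfock.X_apply_Y, ← hk]
  match_scalars
  · ring
  · ring
  · linear_combination -((|k| : ℝ) : ℂ) * hsq
  · linear_combination hsq

theorem raising_lowering (u : S) :
    raising k X Y (lowering k X Y u) = -X (X u) - Y (Y u) - ((|k| : ℝ) : ℂ) • u := by
  have hsq := imaginarySign_mul_self hfock.ne_zero
  have hk := abs_mul_imaginarySign hfock.ne_zero
  simp only [lowering, raising, LinearMap.sub_apply, LinearMap.neg_apply, LinearMap.smul_apply,
    map_sub, map_smul, hfock.X_apply_Y, ← hk]
  match_scalars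
  · ring
  · ring
  · linear_combination ((|k| : ℝ) : ℂ) * hsq
  · linear_combination hsq

theorem oscillator_ladder (n : ℕ) :
    -X (X (ladder k X Y f₀ n)) - Y (Y (ladder k X Y f₀ n)) =
      ((2 * n + 1) * (|k| : ℝ) : ℂ) • ladder k X Y f₀ n := by
  induction n with
  | zero =>
    have hground := hfock.raising_lowering f₀
    rw [hfock.lowering_ground, map_zero, eq_comm, sub_eq_zero] at hground
    simpa [ladder] using hground
  | succ n ih =>
    have hraise := hfock.raising_lowering (ladder k X Y f₀ (n + 1))
    rw [ladder_succ, hfock.lowering_raising, ih, ← add_smul, map_smul, eq_sub_iff_add_eq,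
      ← add_smul] at hraise
    rw [ladder_succ, ← hraise]
    congr 1
    push_cast
    ring

theorem lowering_ladder_succ (n : ℕ) : lowering k X Y (ladder k X Y f₀ (n + 1)) =
    ((2 * n + 2) * (|k| : ℝ) : ℂ) • ladder k X Y f₀ n := by
  rw [ladder_succ, hfock.lowering_raising, hfock.oscillator_ladder, ← add_smul]
  congr 1
  ring

theorem lowering_coeff_ne_zero (n : ℕ) : ((2 * n + 2) * (|k| : ℝ) : ℂ) ≠ 0 := by
  have hk := abs_pos.2 hfock.ne_zero
  exact_mod_cast (by positivity : (2 * n + 2) * |k| ≠ 0)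

theorem ladder_ne_zero (n : ℕ) : ladder k X Y f₀ n ≠ 0 := by
  induction n with
  | zero => exact hfock.ground_ne_zero
  | succ n ih =>
    intro hzero
    have hlower := hfock.lowering_ladder_succ n
    rw [hzero, map_zero] at hlower
    exact smul_ne_zero (hfock.lowering_coeff_ne_zero n) ih hlower.symm

theorem matrixAct_lapMatrix0_ladder (n : ℕ) :
    matrixAct (lapMatrix0 X Y T) ![ladder k X Y f₀ n] =
      (eigA k n : ℂ) • ![ladder k X Y f₀ n] := by
  rw [matrixAct_lapMatrix0, hfock.oscillator_ladder, hfock.central, hfock.central, Matrix.smul_cons,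
    Matrix.smul_empty]
  congr 1
  rw [smul_smul, ← sub_smul, eigA]
  congr 1
  push_cast
  linear_combination -(k : ℂ) ^ 2 * Complex.I_sq

theorem Y_ladder_mem_span (n : ℕ) :
    Y (ladder k X Y f₀ n) ∈ Submodule.span ℂ (Set.range (ladder k X Y f₀)) := by
  have hY : Y (ladder k X Y f₀ n) = (imaginarySign k / 2) •
      (raising k X Y (ladder k X Y f₀ n) + lowering k X Y (ladder k X Y f₀ n)) := by
    simp only [raising, lowering, LinearMap.sub_apply, LinearMap.neg_apply, LinearMap.smul_apply]
    match_scalars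
    · linear_combination imaginarySign_mul_self hfock.ne_zero
    · ring
  rw [hY, ← ladder_succ]
  refine Submodule.smul_mem _ _ (add_mem (Submodule.subset_span ⟨_, rfl⟩) ?_)
  cases n with
  | zero => exact hfock.lowering_ground ▸ zero_mem _
  | succ n =>
    rw [hfock.lowering_ladder_succ]
    exact Submodule.smul_mem _ _ (Submodule.subset_span ⟨_, rfl⟩)

theorem Y_pow_mem_span_ladder (n : ℕ) :
    (Y ^ n) f₀ ∈ Submodule.span ℂ (Set.range (ladder k X Y f₀)) := by
  have hinv : Submodule.span ℂ (Set.range (ladder k X Y f₀)) ≤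
      (Submodule.span ℂ (Set.range (ladder k X Y f₀))).comap Y :=
    Submodule.span_le.2 (Set.range_subset_iff.2 hfock.Y_ladder_mem_span)
  induction n with
  | zero => exact Submodule.subset_span ⟨0, rfl⟩
  | succ n ih =>
    rw [pow_succ', Module.End.mul_apply]
    exact hinv ih

theorem eq_zero_of_inner_ladder {x : E}
    (hx : ∀ n, inner ℂ ((ladder k X Y f₀ n : S) : E) x = 0) : x = 0 := by
  have hspan : Submodule.span ℂ (Set.range (ladder k X Y f₀)) ≤ (ℂ ∙ x)ᗮ.comap S.subtype :=
    Submodule.span_le.2 <| Set.range_subset_iff.2 fun n =>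
      Submodule.mem_orthogonal_singleton_iff_inner_left.2 (hx n)
  exact hfock.cyclic x fun n =>
    Submodule.mem_orthogonal_singleton_iff_inner_left.1 (hspan (hfock.Y_pow_mem_span_ladder n))

theorem isOrthogonalBasis_ladder :
    IsOrthogonalBasis fun n => toForms ![ladder k X Y f₀ n] where
  ne_zero n hzero := hfock.ladder_ne_zero n
    (congrFun (toForms_injective (hzero.trans (map_zero _).symm)) 0)
  orthogonal m n hmn :=
    (isMatrixAdjoint_lapMatrix0 hfock.isSkewSymmetric_X hfock.isSkewSymmetric_Y
      hfock.isSkewSymmetric_T).inner_eq_zero_of_ne (hfock.matrixAct_lapMatrix0_ladder m)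
      (hfock.matrixAct_lapMatrix0_ladder n) ((eigA_strictMono hfock.ne_zero).injective.ne hmn)
  total x hx := by
    ext i
    fin_cases i
    exact hfock.eq_zero_of_inner_ladder fun n => by simpa [inner_toForms_left] using hx n

theorem curl_groundVector : matrixAct (curlMatrix X Y T) (groundVector k f₀) =
    ((-|k| : ℝ) : ℂ) • groundVector k f₀ := by
  have hsq := imaginarySign_mul_self hfock.ne_zero
  have hk := abs_mul_imaginarySign hfock.ne_zero
  have hground : X f₀ = imaginarySign k • Y f₀ := sub_eq_zero.1 hfock.lowering_ground
  rw [groundVector, matrixAct_curlMatrix]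
  simp only [map_smul, hfock.central, hground, map_zero, ← hk, Complex.ofReal_neg]
  ext i
  fin_cases i
  · simp only [Fin.zero_eta, Matrix.cons_val_zero, Pi.smul_apply]
    congr 1
    match_scalars
    linear_combination ((|k| : ℝ) : ℂ) * hsq
  · simp only [Fin.mk_one, Matrix.cons_val_one, Matrix.cons_val_zero, Pi.smul_apply]
    congr 1
    module
  · simp only [Fin.reduceFinMk, Matrix.cons_val, Pi.smul_apply, smul_zero]
    congr 1
    match_scalars
    linear_combination -hsq

theorem curl_coclosedVector_ladder {μ : ℝ} (hμ : μ ≠ 0) {n : ℕ} (hquad : μ ^ 2 + μ = eigA k n) :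
    matrixAct (curlMatrix X Y T) (coclosedVector X Y T μ (ladder k X Y f₀ n)) =
      (μ : ℂ) • coclosedVector X Y T μ (ladder k X Y f₀ n) := by
  refine curl_coclosedVector hfock.commutator hfock.commute_X hfock.commute_Y
    (Complex.ofReal_ne_zero.2 hμ) ?_
  rw [hfock.matrixAct_lapMatrix0_ladder, ← hquad]
  push_cast
  rfl

theorem curl_curlVector (i : ℕ ⊕ ℕ) : matrixAct (curlMatrix X Y T) (curlVector k X Y T f₀ i) =
    (curlValue k i : ℂ) • curlVector k X Y T f₀ i := by
  have hne := curlValue_ne_zero hfock.ne_zero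
  rcases i with n | _ | n
  · exact hfock.curl_coclosedVector_ladder (hne _) (neg_rootA_add_half_quadratic k n)
  · exact hfock.curl_groundVector
  · exact hfock.curl_coclosedVector_ladder (hne _) (rootA_sub_half_quadratic k (n + 1))

theorem coclosedVector_ne_zero {μ : ℝ} (hμ : k ^ 2 < μ ^ 2) {f : S} (hf : f ≠ 0) :
    coclosedVector X Y T μ f ≠ 0 := by
  intro hzero
  have hμ0 : (μ : ℂ) ≠ 0 :=
    Complex.ofReal_ne_zero.2 (sq_pos_iff.1 ((sq_nonneg k).trans_lt hμ))
  have hthird := congrArg ((μ : ℂ) • ·) (congrFun hzero 2)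
  simp only [coclosedVector_eq, hfock.central, Matrix.cons_val, Pi.zero_apply, smul_zero,
    smul_smul, ← add_smul] at hthird
  refine smul_ne_zero (fun hcoeff => hμ.ne' ?_) hf hthird
  have hsq : (μ : ℂ) ^ 2 = (k : ℂ) ^ 2 := by
    rw [mul_add, mul_inv_cancel_left₀ hμ0] at hcoeff
    linear_combination hcoeff - (k : ℂ) ^ 2 * Complex.I_sq
  exact_mod_cast hsq

theorem curlVector_ne_zero (i : ℕ ⊕ ℕ) : curlVector k X Y T f₀ i ≠ 0 := by
  rcases i with n | _ | n
  · exact hfock.coclosedVector_ne_zero (sq_lt_sq_curlValue_inl hfock.ne_zero n)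
      (hfock.ladder_ne_zero n)
  · exact fun hzero => hfock.ground_ne_zero (congrFun hzero 0)
  · exact hfock.coclosedVector_ne_zero (sq_lt_sq_curlValue_inr_succ hfock.ne_zero n)
      (hfock.ladder_ne_zero (n + 1))

theorem grad_ladder_ne_zero (n : ℕ) : matrixAct (gradMatrix X Y T) ![ladder k X Y f₀ n] ≠ 0 := by
  intro hzero
  have hthird := congrFun hzero 2
  rw [matrixAct_gradMatrix] at hthird
  simp only [hfock.central, Matrix.cons_val, Pi.zero_apply] at hthird
  exact smul_ne_zero (mul_ne_zero (Complex.ofReal_ne_zero.2 hfock.ne_zero) Complex.I_ne_zero)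
    (hfock.ladder_ne_zero n) hthird

theorem matrixAct_lapMatrix1_formVector (i : ℕ ⊕ (ℕ ⊕ ℕ)) :
    matrixAct (lapMatrix1 X Y T) (formVector k X Y T f₀ i) =
      (formValue k i : ℂ) • formVector k X Y T f₀ i := by
  rcases i with n | i
  · exact matrixAct_lapMatrix1_grad hfock.commutator hfock.commute_X hfock.commute_Y
      (hfock.matrixAct_lapMatrix0_ladder n)
  · simp only [formVector, formValue, Sum.elim_inr, ← curlValue_sq, Complex.ofReal_pow]
    exact matrixAct_lapMatrix1_of_curl hfock.commutator hfock.commute_X hfock.commute_Y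
      (Complex.ofReal_ne_zero.2 (curlValue_ne_zero hfock.ne_zero i)) (hfock.curl_curlVector i)

theorem inner_formVector_eq_zero {i j : ℕ ⊕ (ℕ ⊕ ℕ)} (hij : i ≠ j) :
    inner ℂ (toForms (formVector k X Y T f₀ i)) (toForms (formVector k X Y T f₀ j)) = 0 := by
  have hcurl := isMatrixAdjoint_curlMatrix hfock.isSkewSymmetric_X hfock.isSkewSymmetric_Y
    hfock.isSkewSymmetric_T
  have hgrad (n : ℕ) : matrixAct (curlMatrix X Y T) (formVector k X Y T f₀ (.inl n)) =
      ((0 : ℝ) : ℂ) • formVector k X Y T f₀ (.inl n) := by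
    rw [Complex.ofReal_zero, zero_smul]
    exact curl_grad hfock.commutator hfock.commute_X hfock.commute_Y _
  have hne := curlValue_ne_zero hfock.ne_zero
  rcases i with m | i <;> rcases j with n | j
  · exact (isMatrixAdjoint_lapMatrix1 hfock.isSkewSymmetric_X hfock.isSkewSymmetric_Y
      hfock.isSkewSymmetric_T).inner_eq_zero_of_ne (hfock.matrixAct_lapMatrix1_formVector (.inl m))
      (hfock.matrixAct_lapMatrix1_formVector (.inl n))
      ((eigA_strictMono hfock.ne_zero).injective.ne (ne_of_apply_ne Sum.inl hij))
  · exact hcurl.inner_eq_zero_of_ne (hgrad m) (hfock.curl_curlVector j) (hne j).symm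
  · exact hcurl.inner_eq_zero_of_ne (hfock.curl_curlVector i) (hgrad n) (hne i)
  · exact hcurl.inner_eq_zero_of_ne (hfock.curl_curlVector i) (hfock.curl_curlVector j)
      ((curlValue_injective hfock.ne_zero).ne (ne_of_apply_ne Sum.inr hij))

theorem coclosedVector_ground : coclosedVector X Y T ((|k| : ℝ) : ℂ) f₀ = 0 := by
  have hk := abs_mul_imaginarySign hfock.ne_zero
  have hsq := imaginarySign_mul_self hfock.ne_zero
  have habs : ((|k| : ℝ) : ℂ) ≠ 0 := Complex.ofReal_ne_zero.2 (abs_ne_zero.2 hfock.ne_zero)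
  have hground : X f₀ = imaginarySign k • Y f₀ := sub_eq_zero.1 hfock.lowering_ground
  have hinv (w : S) : ((|k| : ℝ) : ℂ)⁻¹ • ((k : ℂ) * Complex.I) • w = imaginarySign k • w := by
    rw [← hk, mul_smul, inv_smul_smul₀ habs]
  have hjj (w : S) : imaginarySign k • imaginarySign k • w = -w := by
    rw [smul_smul, hsq, neg_one_smul]
  have hjk (w : S) :
      imaginarySign k • ((k : ℂ) * Complex.I) • w = -(((|k| : ℝ) : ℂ) • w) := by
    rw [← hk, mul_smul, smul_comm, hjj, smul_neg]
  simp only [coclosedVector_eq, hfock.central, map_smul, hinv, hground, hjj, hjk, add_neg_cancel,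
    neg_add_cancel]
  simp

variable {K : Submodule ℂ (Fin 3 → S)}

theorem vertical_ladder_mem (hK : ∀ i, formVector k X Y T f₀ i ∈ K) (n : ℕ) :
    ![0, 0, ladder k X Y f₀ n] ∈ K ∧
      matrixAct (curlMatrix X Y T) ![0, 0, ladder k X Y f₀ n] ∈ K := by
  have hgrad : matrixAct (gradMatrix X Y T) ![T (ladder k X Y f₀ n)] ∈ K := by
    have hsmul : ![T (ladder k X Y f₀ n)] = ((k : ℂ) * Complex.I) • ![ladder k X Y f₀ n] := by
      simp [hfock.central]
    rw [hsmul, map_smul]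
    exact K.smul_mem _ (hK (.inl n))
  refine vertical_mem_of_coclosedVector_mem (ν := ((rootA k n - 1 / 2 : ℝ) : ℂ))
    (fun heq => ?_) hgrad (hK (.inr (.inl n))) ?_
  · have hroot := abs_add_half_le_rootA hfock.ne_zero n
    have hneg : -(rootA k n + 1 / 2) = rootA k n - 1 / 2 := Complex.ofReal_injective heq
    linarith [abs_nonneg k]
  · cases n with
    | zero =>
      rw [rootA_zero, add_sub_cancel_right]
      exact hfock.coclosedVector_ground ▸ K.zero_mem
    | succ n => exact hK (.inr (.inr (n + 1)))

theorem horizontal_mem (hK : ∀ i, formVector k X Y T f₀ i ∈ K) (n : ℕ) :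
    ![lowering k X Y (ladder k X Y f₀ n), imaginarySign k • lowering k X Y (ladder k X Y f₀ n), 0]
        ∈ K ∧
      ![ladder k X Y f₀ (n + 1), -imaginarySign k • ladder k X Y f₀ (n + 1), 0] ∈ K := by
  obtain ⟨hvert, hcurl⟩ := hfock.vertical_ladder_mem hK n
  have hgrad : matrixAct (gradMatrix X Y T) ![ladder k X Y f₀ n] ∈ K := hK (.inl n)
  have hsq := imaginarySign_mul_self hfock.ne_zero
  rw [matrixAct_curlMatrix] at hcurl
  rw [matrixAct_gradMatrix, hfock.central] at hgrad
  constructor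
  · convert K.add_mem (K.sub_mem hgrad (K.smul_mem (imaginarySign k) hcurl))
      (K.smul_mem (-(k * Complex.I) - imaginarySign k) hvert) using 1
    ext i
    fin_cases i
    · simp [lowering]
    · simp [lowering, smul_sub, smul_smul, hsq, add_comm]
    · simp
      module
  · convert K.add_mem (K.sub_mem (K.neg_mem hgrad) (K.smul_mem (imaginarySign k) hcurl))
      (K.smul_mem (k * Complex.I - imaginarySign k) hvert) using 1
    ext i
    fin_cases i
    · simp [ladder_succ, raising]
    · simp [ladder_succ, raising, smul_sub, smul_smul, hsq]
      abel
    · simp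
      module

theorem single_ladder_mem (hK : ∀ i, formVector k X Y T f₀ i ∈ K) (n : ℕ) (i : Fin 3) :
    Pi.single i (ladder k X Y f₀ n) ∈ K := by
  have hj := imaginarySign_ne_zero hfock.ne_zero
  have hpos : ![ladder k X Y f₀ n, imaginarySign k • ladder k X Y f₀ n, 0] ∈ K := by
    refine (K.smul_mem_iff (hfock.lowering_coeff_ne_zero n)).1 ?_
    simpa [hfock.lowering_ladder_succ, smul_comm (imaginarySign k)] using
      (hfock.horizontal_mem hK (n + 1)).1
  have hneg : ![ladder k X Y f₀ n, -imaginarySign k • ladder k X Y f₀ n, 0] ∈ K := by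
    cases n with
    | zero => exact hK (.inr (.inr 0))
    | succ n => exact (hfock.horizontal_mem hK n).2
  fin_cases i
  · refine (K.smul_mem_iff (two_ne_zero (α := ℂ))).1 ?_
    convert K.add_mem hpos hneg using 1
    ext i
    fin_cases i <;> simp [two_smul]
  · refine (K.smul_mem_iff (mul_ne_zero two_ne_zero hj)).1 ?_
    convert K.sub_mem hpos hneg using 1
    ext i
    fin_cases i <;> simp [two_mul, add_smul]
  · convert (hfock.vertical_ladder_mem hK n).1 using 1
    ext i
    fin_cases i <;> simp

theorem isOrthogonalBasis_formVector :
    IsOrthogonalBasis fun i => toForms (formVector k X Y T f₀ i) where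
  ne_zero i hzero := by
    have hvec : formVector k X Y T f₀ i = 0 := toForms_injective (hzero.trans (map_zero _).symm)
    rcases i with n | i
    · exact hfock.grad_ladder_ne_zero n hvec
    · exact hfock.curlVector_ne_zero i hvec
  orthogonal _ _ hij := hfock.inner_formVector_eq_zero hij
  total x hx := by
    have hsingle := hfock.single_ladder_mem (K := (ℂ ∙ x)ᗮ.comap toForms) fun i =>
      Submodule.mem_orthogonal_singleton_iff_inner_left.2 (hx i)
    refine PiLp.ext fun i => hfock.eq_zero_of_inner_ladder fun n => ?_
    have hinner := Submodule.mem_orthogonal_singleton_iff_inner_left.1 (hsingle n i)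
    rwa [inner_toForms_left, Finset.sum_eq_single i (fun j _ hji => by simp [hji]) (by simp),
      Pi.single_eq_same] at hinner

end IsFockModel

/-! ## The ground state -/

section Moments

open FourierTransform

variable {w : ℝ → ℂ}

theorem ae_eq_zero_of_fourier_eq_zero (hw : Integrable w) (hfourier : ∀ y, 𝓕 w y = 0) :
    w =ᵐ[volume] 0 := by
  refine ae_eq_zero_of_integral_contDiff_smul_eq_zero hw.locallyIntegrable fun g hg hgc => ?_
  let G : SchwartzMap ℝ ℂ := (hgc.comp_left (g := Complex.ofReal) rfl).toSchwartzMap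
    (Complex.ofRealCLM.contDiff.comp hg)
  let H : SchwartzMap ℝ ℂ := 𝓕⁻ G
  have hH (x : ℝ) : 𝓕 (H : ℝ → ℂ) x = g x := by
    rw [← SchwartzMap.fourier_coe, FourierTransform.fourier_fourierInv_eq]
    rfl
  have hparseval := VectorFourier.integral_fourierIntegral_smul_eq_flip (L := innerₗ ℝ)
    (μ := volume) (ν := volume) Real.continuous_fourierChar continuous_inner H.integrable hw
  rw [flip_innerₗ] at hparseval
  calc ∫ x, g x • w x = ∫ x, 𝓕 (H : ℝ → ℂ) x • w x := by
        simp only [hH, Complex.real_smul, smul_eq_mul]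
    _ = ∫ x, H x • 𝓕 w x := hparseval
    _ = 0 := by simp only [hfourier, smul_zero, integral_zero]

variable (hw : AEStronglyMeasurable w)
  (hexp : ∀ a : ℝ, Integrable fun x => Real.exp (a * |x|) * ‖w x‖)
  (hmoment : ∀ n : ℕ, ∫ x : ℝ, (x : ℂ) ^ n * w x = 0)
include hw hexp hmoment

theorem integral_cexp_mul_eq_zero_of_moments (z : ℂ) : ∫ x : ℝ, Complex.exp (z * x) * w x = 0 := by
  have hterm (n : ℕ) : ∫ x : ℝ, (z * x) ^ n / n.factorial * w x = 0 := by
    have hrw (x : ℝ) : (z * x) ^ n / n.factorial * w x =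
        z ^ n / n.factorial * ((x : ℂ) ^ n * w x) := by ring
    simp only [hrw]
    rw [integral_const_mul, hmoment, mul_zero]
  have hseries (x : ℝ) : HasSum (fun n : ℕ => (z * x) ^ n / n.factorial) (Complex.exp (z * x)) := by
    rw [Complex.exp_eq_exp_ℂ]
    exact NormedSpace.expSeries_div_hasSum_exp _
  have hsum := hasSum_integral_of_dominated_convergence (μ := volume)
    (F := fun (n : ℕ) (x : ℝ) => (z * x) ^ n / n.factorial * w x)
    (f := fun x : ℝ => Complex.exp (z * x) * w x)
    (fun (n : ℕ) (x : ℝ) => (‖z‖ * |x|) ^ n / n.factorial * ‖w x‖)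
    (fun n => (by fun_prop : Continuous fun x : ℝ =>
      (z * x) ^ n / n.factorial).aestronglyMeasurable.mul hw)
    (fun n => .of_forall fun x => by simp)
    (.of_forall fun x => (Real.summable_pow_div_factorial _).mul_right _)
    ((hexp ‖z‖).congr (.of_forall fun x => by
      simp only [tsum_mul_right, Real.exp_eq_exp_ℝ, NormedSpace.exp_eq_tsum_div]))
    (.of_forall fun x => (hseries x).mul_right _)
  simp only [hterm] at hsum
  exact hsum.unique hasSum_zero

theorem ae_eq_zero_of_moments_eq_zero : w =ᵐ[volume] 0 := by
  have hint : Integrable w := by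
    simpa [integrable_norm_iff hw] using hexp 0
  refine ae_eq_zero_of_fourier_eq_zero hint fun y => ?_
  rw [Real.fourier_eq', ← integral_cexp_mul_eq_zero_of_moments hw hexp hmoment
    (-2 * Real.pi * y * Complex.I)]
  refine integral_congr_ae (.of_forall fun x => ?_)
  simp only [smul_eq_mul, Real.inner_apply]
  congr 2
  push_cast
  ring

end Moments

section Gaussian

open Polynomial
open scoped SchwartzMap

theorem exists_abs_eval_mul_exp_neg_sq_le (q : ℝ[X]) :
    ∃ C, ∀ x : ℝ, |q.eval x| * Real.exp (-(x ^ 2 / 2)) ≤ C := by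
  induction q using Polynomial.induction_on' with
  | add p q hp hq =>
    obtain ⟨C, hC⟩ := hp
    obtain ⟨D, hD⟩ := hq
    refine ⟨C + D, fun x => le_trans ?_ (add_le_add (hC x) (hD x))⟩
    rw [eval_add, ← add_mul]
    gcongr
    exact abs_add_le _ _
  | monomial n a =>
    refine ⟨|a| * (n.factorial * Real.exp (1 / 2)), fun x => ?_⟩
    have hpow := (div_le_iff₀' (by positivity)).1
      (Real.pow_div_factorial_le_exp |x| (abs_nonneg x) n)
    have hsq : |x| - x ^ 2 / 2 ≤ 1 / 2 := by
      rw [← sq_abs]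
      linarith [sq_nonneg (|x| - 1)]
    rw [eval_monomial, abs_mul, abs_pow, mul_assoc]
    refine mul_le_mul_of_nonneg_left ?_ (abs_nonneg a)
    calc |x| ^ n * Real.exp (-(x ^ 2 / 2))
        ≤ n.factorial * Real.exp |x| * Real.exp (-(x ^ 2 / 2)) := by gcongr
      _ = n.factorial * Real.exp (|x| - x ^ 2 / 2) := by
        rw [mul_assoc, ← Real.exp_add, sub_eq_add_neg]
      _ ≤ n.factorial * Real.exp (1 / 2) := by gcongr

/-- The standard Gaussian `exp (-x² / 2)` as a Schwartz function. -/
def standardGaussian : 𝓢(ℝ, ℝ) where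
  toFun x := Real.exp (-(x ^ 2 / 2))
  smooth' := by fun_prop
  decay' m n := by
    obtain ⟨C, hC⟩ := exists_abs_eval_mul_exp_neg_sq_le
      (X ^ m * (hermite n).map (Int.castRingHom ℝ))
    refine ⟨C, fun x => le_of_eq_of_le ?_ (hC x)⟩
    rw [norm_iteratedFDeriv_eq_norm_iteratedDeriv, iteratedDeriv_eq_iterate,
      deriv_gaussian_eq_hermite_mul_gaussian, eval_mul, eval_pow, eval_X, ← algebraMap_int_eq,
      eval_map_algebraMap]
    simp [abs_mul, mul_assoc]

/-- The Gaussian `exp (-(c x)² / 2)` as a complex valued Schwartz function. -/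
def gaussian (c : ℝˣ) : 𝓢(ℝ, ℂ) :=
  SchwartzMap.postcompCLM (𝕜 := ℝ) Complex.ofRealCLM
    (SchwartzMap.compCLMOfContinuousLinearEquiv ℝ (ContinuousLinearEquiv.unitsEquivAut ℝ c)
      standardGaussian)

theorem gaussian_apply (c : ℝˣ) (x : ℝ) : gaussian c x = Real.exp (-((x * c) ^ 2 / 2)) := rfl

end Gaussian

section SmoothnessCriterion

variable {h : ℝ}

theorem fderiv_orbit_apply {u : L2R} {D : (ℝ × ℝ × ℝ) →L[ℝ] L2R}
    (hu : HasFDerivAt (orbit h u ∘ ofCoord) D 0) (p v : ℝ × ℝ × ℝ) :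
    fderiv ℝ (orbit h u ∘ ofCoord) p v =
      orbit h (D v) (ofCoord p) - (p.1 * v.2.1) • orbit h (D (0, 0, 1)) (ofCoord p) := by
  have hv : (leftDiff (ofCoord p).a).symm v = v - (p.1 * v.2.1) • ((0, 0, 1) : ℝ × ℝ × ℝ) := by
    rw [ContinuousLinearEquiv.symm_apply_eq]
    ext <;> simp [leftDiff, ofCoord]
  have hderiv : HasFDerivAt (orbit h u ∘ ofCoord) _ p := hasFDerivAt_orbit_coord hu (ofCoord p)
  rw [hderiv.fderiv, ContinuousLinearMap.comp_apply, ContinuousLinearEquiv.coe_coe, hv, map_sub,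
    map_smul]
  rfl

theorem subset_smoothSubspace {V : Set L2R}
    (hV : ∀ u ∈ V, ∃ D : (ℝ × ℝ × ℝ) →L[ℝ] L2R,
      HasFDerivAt (orbit h u ∘ ofCoord) D 0 ∧ ∀ v, D v ∈ V) :
    V ⊆ smoothSubspace h := by
  have hdiff {u : L2R} (hu : u ∈ V) : Differentiable ℝ (orbit h u ∘ ofCoord) := fun p =>
    let ⟨_, hD, _⟩ := hV u hu
    (hasFDerivAt_orbit_coord hD (ofCoord p)).differentiableAt
  have hcontDiff (n : ℕ) : ∀ u ∈ V, ContDiff ℝ n (orbit h u ∘ ofCoord) := by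
    induction n with
    | zero => exact fun u hu => contDiff_zero.2 (hdiff hu).continuous
    | succ n ih =>
      intro u hu
      obtain ⟨D, hD, hDV⟩ := hV u hu
      rw [Nat.cast_succ, contDiff_succ_iff_fderiv_apply]
      refine ⟨hdiff hu, fun htop => absurd htop (by simp), fun v => ?_⟩
      simp only [fderiv_orbit_apply hD]
      exact (ih _ (hDV v)).sub
        ((contDiff_fst.mul contDiff_const).smul (ih _ (hDV (0, 0, 1))))
  exact fun u hu => mem_smoothSubspace.2 (contDiff_infty.2 fun n => hcontDiff n u hu)

end SmoothnessCriterion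

section Taylor

theorem norm_sub_sub_le_of_norm_deriv2_le {E : Type*} [NormedAddCommGroup E] [NormedSpace ℝ E]
    {G G' G'' : ℝ → E} (hG : ∀ s, HasDerivAt G (G' s) s) (hG' : ∀ s, HasDerivAt G' (G'' s) s)
    {M : ℝ} (hM : ∀ s ∈ Set.Icc (0 : ℝ) 1, ‖G'' s‖ ≤ M) : ‖G 1 - G 0 - G' 0‖ ≤ M := by
  have hM0 : 0 ≤ M := (norm_nonneg _).trans (hM 0 (by simp))
  have hfirst (s : ℝ) (hs : s ∈ Set.Icc (0 : ℝ) 1) : ‖G' s - G' 0‖ ≤ M := by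
    have hbound := norm_image_sub_le_of_norm_deriv_le_segment'
      (fun r _ => (hG' r).hasDerivWithinAt) (fun r hr => hM r (Set.Ico_subset_Icc_self hr)) s hs
    nlinarith [hs.2]
  have hline (s : ℝ) : HasDerivAt (fun r => G r - r • G' 0) (G' s - G' 0) s := by
    simpa using (hG s).fun_sub ((hasDerivAt_id s).smul_const (G' 0))
  have hbound := norm_image_sub_le_of_norm_deriv_le_segment'
    (fun r _ => (hline r).hasDerivWithinAt)
    (fun r hr => hfirst r (Set.Ico_subset_Icc_self hr)) 1 (by simp)
  simpa [sub_right_comm] using hbound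

variable {θ d x : ℝ}

theorem hasDerivAt_cexp_mul_translate {f : ℝ → ℂ} {f' : ℂ} {s : ℝ}
    (hf : HasDerivAt f f' (x + s * d)) :
    HasDerivAt (fun s : ℝ => Complex.exp (s * (θ * Complex.I)) * f (x + s * d))
      (θ * Complex.I * (Complex.exp (s * (θ * Complex.I)) * f (x + s * d)) +
        d * (Complex.exp (s * (θ * Complex.I)) * f')) s := by
  have hexp : HasDerivAt (fun s : ℝ => Complex.exp (s * (θ * Complex.I)))
      (Complex.exp (s * (θ * Complex.I)) * (θ * Complex.I)) s := by
    simpa using ((hasDerivAt_id s).ofReal_comp.mul_const (θ * Complex.I)).cexp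
  have harg : HasDerivAt (fun s : ℝ => x + s * d) d s := by
    simpa using ((hasDerivAt_id s).mul_const d).const_add x
  refine (hexp.fun_mul (hf.scomp s harg)).congr_deriv ?_
  rw [Function.comp_apply, Complex.real_smul]
  ring

theorem norm_cexp_mul_translate_sub_le {f f' f'' : ℝ → ℂ} (hf : ∀ y, HasDerivAt f (f' y) y)
    (hf' : ∀ y, HasDerivAt f' (f'' y) y) {B : ℝ}
    (hB : ∀ s ∈ Set.Icc (0 : ℝ) 1,
      ‖f (x + s * d)‖ ≤ B ∧ ‖f' (x + s * d)‖ ≤ B ∧ ‖f'' (x + s * d)‖ ≤ B) :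
    ‖Complex.exp (θ * Complex.I) * f (x + d) - f x - (θ * Complex.I * f x + d * f' x)‖ ≤
      (|θ| + |d|) ^ 2 * B := by
  have hfirst (s : ℝ) := hasDerivAt_cexp_mul_translate (θ := θ) (hf (x + s * d))
  have hsecond (s : ℝ) := ((hfirst s).const_mul (θ * Complex.I)).fun_add
    ((hasDerivAt_cexp_mul_translate (θ := θ) (hf' (x + s * d))).const_mul (d : ℂ))
  have htaylor := norm_sub_sub_le_of_norm_deriv2_le (M := (|θ| + |d|) ^ 2 * B) hfirst hsecond
    fun s hs => ?_
  · simpa using htaylor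
  obtain ⟨h0, h1, h2⟩ := hB s hs
  have hphase : ‖Complex.exp (s * (θ * Complex.I))‖ = 1 := by
    rw [← mul_assoc, ← Complex.ofReal_mul, Complex.norm_exp_ofReal_mul_I]
  have hterm {c : ℂ} (hc : ‖c‖ ≤ B) : ‖Complex.exp (s * (θ * Complex.I)) * c‖ ≤ B := by
    rwa [norm_mul, hphase, one_mul]
  have hθ : ‖(θ * Complex.I : ℂ)‖ = |θ| := by simp
  have hd : ‖(d : ℂ)‖ = |d| := by simp
  calc _ ≤ |θ| * (|θ| * B + |d| * B) + |d| * (|θ| * B + |d| * B) := by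
        exact norm_add_le_of_le
          (norm_mul_le_of_le hθ.le (norm_add_le_of_le (norm_mul_le_of_le hθ.le (hterm h0))
            (norm_mul_le_of_le hd.le (hterm h1))))
          (norm_mul_le_of_le hd.le (norm_add_le_of_le (norm_mul_le_of_le hθ.le (hterm h1))
            (norm_mul_le_of_le hd.le (hterm h2))))
    _ = (|θ| + |d|) ^ 2 * B := by ring

end Taylor

section SchwartzVectors

open scoped SchwartzMap

theorem exists_norm_translate_le (f : 𝓢(ℝ, ℂ)) :
    ∃ C, 0 ≤ C ∧ ∀ x r : ℝ, |r| ≤ 1 → ‖f (x + r)‖ ≤ C / (1 + |x|) ^ 3 := by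
  obtain ⟨C, hC⟩ : ∃ C, ∀ x : ℝ, (1 + |x|) ^ 3 * ‖f x‖ ≤ C := ⟨_, fun x => by
    simpa only [norm_iteratedFDeriv_zero, Real.norm_eq_abs] using
      SchwartzMap.one_add_le_sup_seminorm_apply (𝕜 := ℝ) (m := (3, 0)) le_rfl le_rfl f x⟩
  have hC0 : 0 ≤ C := le_trans (by positivity) (hC 0)
  refine ⟨8 * C, by positivity, fun x r hr => ?_⟩
  have hx : 1 + |x| ≤ 2 * (1 + |x + r|) := by
    have htri : |x| ≤ |x + r| + |r| := by simpa using abs_sub (x + r) r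
    linarith [abs_nonneg (x + r)]
  rw [le_div_iff₀' (by positivity)]
  calc (1 + |x|) ^ 3 * ‖f (x + r)‖ ≤ (2 * (1 + |x + r|)) ^ 3 * ‖f (x + r)‖ := by gcongr
    _ = 8 * ((1 + |x + r|) ^ 3 * ‖f (x + r)‖) := by ring
    _ ≤ 8 * C := by gcongr; exact hC _

variable (h : ℝ)

/-- The operator `dρ_h(v)` on Schwartz functions, for the left invariant vector field with value
`v` at the unit element: `X`, `Y` and `T` act as `h d/dx`, `2 π i x` and `2 π i h`. -/
def schwartzField (v : ℝ × ℝ × ℝ) : 𝓢(ℝ, ℂ) →L[ℂ] 𝓢(ℝ, ℂ) :=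
  ((h * v.1 : ℝ) : ℂ) • SchwartzMap.derivCLM ℂ ℂ +
    SchwartzMap.smulLeftCLM ℂ fun x : ℝ =>
      ((2 * Real.pi * (h * v.2.2 + v.2.1 * x) : ℝ) : ℂ) * Complex.I

theorem schwartzField_apply (v : ℝ × ℝ × ℝ) (f : 𝓢(ℝ, ℂ)) (x : ℝ) :
    schwartzField h v f x =
      ((2 * Real.pi * (h * v.2.2 + v.2.1 * x) : ℝ) : ℂ) * Complex.I * f x +
        ((h * v.1 : ℝ) : ℂ) * deriv f x := by
  have hgrowth : Function.HasTemperateGrowth fun x : ℝ =>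
      ((2 * Real.pi * (h * v.2.2 + v.2.1 * x) : ℝ) : ℂ) * Complex.I := by
    fun_prop
  rw [schwartzField, add_apply, add_apply, SchwartzMap.smulLeftCLM_apply_apply hgrowth, add_comm]
  rfl

variable {h}

theorem abs_phase_add_abs_translate_le (v : ℝ × ℝ × ℝ) (x : ℝ) :
    |2 * Real.pi * (h * v.2.2 + v.2.1 * x)| + |h * v.1| ≤
      2 * Real.pi * (2 * |h| + 1) * ‖v‖ * (1 + |x|) := by
  have hv1 : |v.1| ≤ ‖v‖ := norm_fst_le v
  have hv2 : |v.2.1| ≤ ‖v‖ := (norm_fst_le v.2).trans (norm_snd_le v)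
  have hv3 : |v.2.2| ≤ ‖v‖ := (norm_snd_le v.2).trans (norm_snd_le v)
  have hpi : 1 ≤ 2 * Real.pi := by linarith [Real.pi_gt_three]
  calc _ ≤ 2 * Real.pi * (|h| * |v.2.2| + |v.2.1| * |x|) + 2 * Real.pi * (|h| * |v.1|) := by
        rw [abs_mul, abs_of_pos Real.two_pi_pos, abs_mul h]
        refine add_le_add ?_ (le_mul_of_one_le_left (by positivity) hpi)
        gcongr
        exact (abs_add_le _ _).trans_eq (by rw [abs_mul, abs_mul])
    _ ≤ 2 * Real.pi * (|h| * ‖v‖ + ‖v‖ * |x|) + 2 * Real.pi * (|h| * ‖v‖) := by gcongr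
    _ = 2 * Real.pi * (2 * |h| + |x|) * ‖v‖ := by ring
    _ ≤ 2 * Real.pi * ((2 * |h| + 1) * (1 + |x|)) * ‖v‖ := by
        gcongr
        nlinarith [abs_nonneg h, abs_nonneg x]
    _ = _ := by ring

theorem exists_norm_schrodingerFun_sub_le (f : 𝓢(ℝ, ℂ)) :
    ∃ C, ∀ v : ℝ × ℝ × ℝ, |h| * ‖v‖ ≤ 1 → ∀ x,
      ‖schrodingerFun h (ofCoord v) f x - f x - schwartzField h v f x‖ ≤
        C * ‖v‖ ^ 2 * ‖(1 + |x|)⁻¹‖ := by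
  let f' := SchwartzMap.derivCLM ℂ ℂ f
  obtain ⟨C₀, hC₀, hf⟩ := exists_norm_translate_le f
  obtain ⟨C₁, hC₁, hf'⟩ := exists_norm_translate_le f'
  obtain ⟨C₂, hC₂, hf''⟩ := exists_norm_translate_le (SchwartzMap.derivCLM ℂ ℂ f')
  refine ⟨(2 * Real.pi * (2 * |h| + 1)) ^ 2 * (C₀ + C₁ + C₂), fun v hv x => ?_⟩
  have hshift {s : ℝ} (hs : s ∈ Set.Icc (0 : ℝ) 1) : |s * (h * v.1)| ≤ 1 := by
    rw [abs_mul, abs_mul, abs_of_nonneg hs.1]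
    have hv1 : |h| * |v.1| ≤ 1 := le_trans (by gcongr; exact norm_fst_le v) hv
    exact mul_le_one₀ hs.2 (by positivity) hv1
  have htaylor := norm_cexp_mul_translate_sub_le (x := x) (d := h * v.1)
    (θ := 2 * Real.pi * (h * v.2.2 + v.2.1 * x)) (B := (C₀ + C₁ + C₂) / (1 + |x|) ^ 3)
    f.hasDerivAt f'.hasDerivAt fun s hs =>
      ⟨(hf x _ (hshift hs)).trans (by gcongr; linarith),
        (hf' x _ (hshift hs)).trans (by gcongr; linarith),
        (hf'' x _ (hshift hs)).trans (by gcongr; linarith)⟩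
  rw [schwartzField_apply]
  refine htaylor.trans ?_
  calc _ ≤ (2 * Real.pi * (2 * |h| + 1) * ‖v‖ * (1 + |x|)) ^ 2 *
        ((C₀ + C₁ + C₂) / (1 + |x|) ^ 3) := by
        gcongr
        exact abs_phase_add_abs_translate_le v x
    _ = _ := by
        rw [Real.norm_of_nonneg (by positivity)]
        field_simp

theorem memLp_inv_one_add_abs : MemLp (fun x : ℝ => (1 + |x|)⁻¹) 2 := by
  rw [memLp_two_iff_integrable_sq (by fun_prop)]
  simpa using integrable_one_add_norm (E := ℝ) (μ := volume) (r := 2) (by simp)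

theorem schrodinger_toLp_sub_ae_eq (v : ℝ × ℝ × ℝ) (f : 𝓢(ℝ, ℂ)) :
    (schrodinger h (ofCoord v) (f.toLp 2 volume) - f.toLp 2 volume -
        (schwartzField h v f).toLp 2 volume : L2R) =ᵐ[volume] fun x =>
      schrodingerFun h (ofCoord v) f x - f x - schwartzField h v f x := by
  have horbit : (schrodinger h (ofCoord v) (f.toLp 2 volume) : ℝ → ℂ) =ᵐ[volume]
      schrodingerFun h (ofCoord v) f :=
    (coeFn_schrodingerOp h _ _).trans (schrodingerFun_congr h _ (f.coeFn_toLp 2 volume))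
  exact (Lp.coeFn_sub _ _).trans
    (((Lp.coeFn_sub _ _).trans (horbit.sub (f.coeFn_toLp 2 volume))).sub
      ((schwartzField h v f).coeFn_toLp 2 volume))

variable (h)

/-- The differential at the unit element of the orbit map of a Schwartz function. -/
def schwartzDiff (f : 𝓢(ℝ, ℂ)) : (ℝ × ℝ × ℝ) →L[ℝ] L2R :=
  LinearMap.toContinuousLinearMap
    { toFun := fun v => (schwartzField h v f).toLp 2 volume
      map_add' := fun v w => by
        have hadd : schwartzField h (v + w) f = schwartzField h v f + schwartzField h w f := by
          ext x
          simp only [schwartzField_apply, add_apply, Prod.fst_add, Prod.snd_add]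
          push_cast
          ring
        rw [hadd]
        rfl
      map_smul' := fun c v => by
        have hsmul : schwartzField h (c • v) f = c • schwartzField h v f := by
          ext x
          simp only [schwartzField_apply, smul_apply, Prod.smul_fst, Prod.smul_snd, smul_eq_mul,
            Complex.real_smul]
          push_cast
          ring
        rw [hsmul]
        rfl }

theorem hasFDerivAt_orbit_toLp (f : 𝓢(ℝ, ℂ)) :
    HasFDerivAt (orbit h (f.toLp 2 volume) ∘ ofCoord) (schwartzDiff h f) 0 := by
  obtain ⟨C, hbound⟩ := exists_norm_schrodingerFun_sub_le (h := h) f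
  let M := memLp_inv_one_add_abs.toLp (fun x : ℝ => (1 + |x|)⁻¹)
  have hsmall : ∀ᶠ v : ℝ × ℝ × ℝ in nhds 0, |h| * ‖v‖ ≤ 1 := by
    have hcont : ContinuousAt (fun v : ℝ × ℝ × ℝ => |h| * ‖v‖) 0 := by fun_prop
    exact (hcont.eventually_lt_const (by simp)).mono fun v => le_of_lt
  have hquadratic : ∀ᶠ v : ℝ × ℝ × ℝ in nhds 0,
      ‖schrodinger h (ofCoord v) (f.toLp 2 volume) - f.toLp 2 volume - schwartzDiff h f v‖ ≤
        C * ‖M‖ * ‖‖v‖ ^ 2‖ := by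
    filter_upwards [hsmall] with v hv
    rw [Real.norm_of_nonneg (by positivity), mul_right_comm]
    refine Lp.norm_le_mul_norm_of_ae_le_mul ?_
    filter_upwards [schrodinger_toLp_sub_ae_eq v f, memLp_inv_one_add_abs.coeFn_toLp]
      with x hx hM
    exact (congrArg norm hx).trans_le ((hbound v hv x).trans_eq (by rw [hM]))
  rw [hasFDerivAt_iff_isLittleO_nhds_zero]
  simp only [zero_add, Function.comp_apply, ofCoord_zero, orbit_one]
  exact (Asymptotics.IsBigO.of_bound _ hquadratic).trans_isLittleO
    (Asymptotics.isLittleO_norm_pow_id one_lt_two)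

theorem toLp_mem_smoothSubspace (f : 𝓢(ℝ, ℂ)) : f.toLp 2 volume ∈ smoothSubspace h := by
  refine subset_smoothSubspace (V := Set.range fun f : 𝓢(ℝ, ℂ) => f.toLp 2 volume) ?_ ⟨f, rfl⟩
  rintro _ ⟨f, rfl⟩
  exact ⟨schwartzDiff h f, hasFDerivAt_orbit_toLp h f, fun v => ⟨schwartzField h v f, rfl⟩⟩

/-- Schwartz functions as smooth vectors of `ρ_h`. -/
def schwartzVector : 𝓢(ℝ, ℂ) →ₗ[ℂ] smoothSubspace h :=
  (SchwartzMap.toLpCLM ℂ ℂ 2 volume).toLinearMap.codRestrict _ (toLp_mem_smoothSubspace h)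

variable {h}

theorem opField_schwartzVector (v : ℝ × ℝ × ℝ) (f : 𝓢(ℝ, ℂ)) :
    opField h v (schwartzVector h f) = schwartzVector h (schwartzField h v f) := by
  refine Subtype.ext ((coe_opField v _).trans ?_)
  exact DFunLike.congr_fun (hasFDerivAt_orbit_toLp h f).fderiv v

theorem schwartzVector_injective : Function.Injective (schwartzVector h) := fun _ _ hfg =>
  SchwartzMap.injective_toLp 2 volume (congrArg Subtype.val hfg)

end SchwartzVectors

section GroundState

open scoped SchwartzMap

theorem norm_gaussian (c : ℝˣ) (x : ℝ) : ‖gaussian c x‖ = Real.exp (-((x * c) ^ 2 / 2)) := by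
  rw [gaussian_apply, Complex.norm_real, Real.norm_of_nonneg (Real.exp_nonneg _)]

theorem gaussian_apply_ne_zero (c : ℝˣ) (x : ℝ) : gaussian c x ≠ 0 :=
  norm_ne_zero_iff.1 ((norm_gaussian c x).trans_ne (Real.exp_ne_zero _))

theorem deriv_gaussian (c : ℝˣ) (x : ℝ) :
    deriv (gaussian c) x = -((c ^ 2 * x : ℝ) : ℂ) * gaussian c x := by
  have hexponent : HasDerivAt (fun y : ℝ => -((y * c) ^ 2 / 2)) (-(c ^ 2 * x)) x := by
    refine (((hasDerivAt_mul_const (c : ℝ)).fun_pow 2).div_const 2).fun_neg.congr_deriv ?_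
    simp only [Nat.cast_ofNat, Nat.add_one_sub_one, pow_one, neg_inj]
    ring
  refine hexponent.exp.ofReal_comp.deriv.trans ?_
  rw [gaussian_apply]
  push_cast
  ring

theorem exists_exp_mul_abs_mul_norm_gaussian_le (a : ℝ) (c : ℝˣ) :
    ∃ (C : ℝ) (c' : ℝˣ), ∀ x : ℝ, Real.exp (a * |x|) * ‖gaussian c x‖ ≤ C * ‖gaussian c' x‖ := by
  refine ⟨Real.exp (a ^ 2 / c ^ 2), Units.mk0 (c / 2 : ℝ) (by simp), fun x => ?_⟩
  rw [norm_gaussian, norm_gaussian, ← Real.exp_add, ← Real.exp_add, Real.exp_le_exp,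
    Units.val_mk0]
  have hc : (c : ℝ) ≠ 0 := c.ne_zero
  have hsquare : 0 ≤ (a - c ^ 2 / 2 * |x|) ^ 2 / c ^ 2 := by positivity
  have hexpand : (a - c ^ 2 / 2 * |x|) ^ 2 / c ^ 2 =
      a ^ 2 / c ^ 2 - a * |x| + c ^ 2 * x ^ 2 / 4 := by
    rw [← sq_abs x]
    field_simp
    ring
  nlinarith [sq_nonneg (c * x)]

theorem integrable_gaussian_mul (c : ℝˣ) (u : L2R) :
    Integrable fun x => gaussian c x * u x :=
  ((gaussian c).memLp 2).integrable_mul (Lp.memLp u)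

theorem eq_zero_of_gaussian_moments_eq_zero (c : ℝˣ) {u : L2R}
    (hu : ∀ n : ℕ, ∫ x : ℝ, (x : ℂ) ^ n * (gaussian c x * u x) = 0) : u = 0 := by
  have hexp (a : ℝ) : Integrable fun x => Real.exp (a * |x|) * ‖gaussian c x * u x‖ := by
    obtain ⟨C, c', hdom⟩ := exists_exp_mul_abs_mul_norm_gaussian_le a c
    refine ((integrable_gaussian_mul c' u).norm.const_mul C).mono'
      ((by fun_prop : Continuous fun x : ℝ => Real.exp (a * |x|)).aestronglyMeasurable.mul
        (integrable_gaussian_mul c u).1.norm) (.of_forall fun x => ?_)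
    rw [Real.norm_of_nonneg (by positivity), norm_mul, norm_mul, ← mul_assoc, ← mul_assoc]
    gcongr ?_ * _
    exact hdom x
  refine Lp.ext ?_
  filter_upwards [ae_eq_zero_of_moments_eq_zero (integrable_gaussian_mul c u).1 hexp hu,
    Lp.coeFn_zero ℂ 2 volume] with x hx hzero
  rw [hzero]
  exact (mul_eq_zero.1 hx).resolve_left (gaussian_apply_ne_zero c x)

variable {h : ℝ}

theorem opField_pow_schwartzVector (v : ℝ × ℝ × ℝ) (f : 𝓢(ℝ, ℂ)) (n : ℕ) :
    (opField h v ^ n) (schwartzVector h f) = schwartzVector h ((schwartzField h v ^ n) f) := by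
  induction n with
  | zero => rfl
  | succ n ih =>
    rw [pow_succ', Module.End.mul_apply, ih, opField_schwartzVector, pow_succ']
    rfl

theorem schwartzField_pow_apply (f : 𝓢(ℝ, ℂ)) (n : ℕ) (x : ℝ) :
    (schwartzField h (0, 1, 0) ^ n) f x = (2 * Real.pi * Complex.I) ^ n * ((x : ℂ) ^ n * f x) := by
  induction n with
  | zero => simp
  | succ n ih =>
    rw [pow_succ', mul_apply_eq_comp, schwartzField_apply, ih]
    push_cast
    ring

theorem inner_opField_pow_gaussian (c : ℝˣ) (n : ℕ) (u : L2R) :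
    inner ℂ ((opField h (0, 1, 0) ^ n) (schwartzVector h (gaussian c)) : L2R) u =
      (-(2 * Real.pi * Complex.I)) ^ n * ∫ x : ℝ, (x : ℂ) ^ n * (gaussian c x * u x) := by
  rw [opField_pow_schwartzVector, L2.inner_def, ← integral_const_mul]
  refine integral_congr_ae ?_
  filter_upwards [SchwartzMap.coeFn_toLp ((schwartzField h (0, 1, 0) ^ n) (gaussian c)) 2 volume]
    with x hx
  change inner ℂ (((schwartzField h (0, 1, 0) ^ n) (gaussian c)).toLp 2 volume x) (u x) = _
  rw [hx, schwartzField_pow_apply, gaussian_apply, RCLike.inner_apply, ← mul_neg]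
  simp only [map_mul, map_pow, map_ofNat, Complex.conj_I, Complex.conj_ofReal]
  ring

theorem lowering_gaussian {c : ℝˣ} (hc : |h| * c ^ 2 = 2 * Real.pi) :
    lowering (2 * Real.pi * h) (opField h (1, 0, 0)) (opField h (0, 1, 0))
      (schwartzVector h (gaussian c)) = 0 := by
  have hscale : h * c ^ 2 = 2 * Real.pi * h / |2 * Real.pi * h| * (2 * Real.pi) := by
    rw [abs_mul, abs_of_pos Real.two_pi_pos, mul_div_mul_left _ _ Real.two_pi_pos.ne', ← hc]
    rcases eq_or_ne h 0 with rfl | hh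
    · simp
    · field_simp
  have hschwartz : schwartzField h (1, 0, 0) (gaussian c) -
      imaginarySign (2 * Real.pi * h) • schwartzField h (0, 1, 0) (gaussian c) = 0 := by
    ext x
    rw [sub_apply, smul_apply, schwartzField_apply, schwartzField_apply, deriv_gaussian]
    have hscale' : (h * c ^ 2 : ℂ) = ((2 * Real.pi * h / |2 * Real.pi * h| : ℝ) : ℂ) *
        (2 * Real.pi) := mod_cast hscale
    simp only [imaginarySign, smul_eq_mul, mul_zero, mul_one, one_mul, zero_add, add_zero, zero_mul,
      zero_apply]
    push_cast at hscale' ⊢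
    linear_combination (-x * gaussian c x : ℂ) * hscale' -
      (2 * Real.pi * h / |2 * Real.pi * h| : ℂ) * 2 * Real.pi * x * gaussian c x * Complex.I_sq
  rw [lowering, LinearMap.sub_apply, LinearMap.smul_apply, opField_schwartzVector,
    opField_schwartzVector, ← map_smul, ← map_sub, hschwartz, map_zero]

theorem exists_isFockModel (hh : h ≠ 0) :
    ∃ f₀, IsFockModel (2 * Real.pi * h) (opField h (1, 0, 0)) (opField h (0, 1, 0))
      (opField h (0, 0, 1)) f₀ := by
  have hc0 : √(2 * Real.pi / |h|) ≠ 0 := by positivity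
  have hc : |h| * ((Units.mk0 _ hc0 : ℝˣ) : ℝ) ^ 2 = 2 * Real.pi := by
    rw [Units.val_mk0, Real.sq_sqrt (by positivity)]
    field_simp
  refine ⟨schwartzVector h (gaussian (Units.mk0 _ hc0)), ?_⟩
  exact
    { ne_zero := mul_ne_zero Real.two_pi_pos.ne' hh
      isSkewSymmetric_X := inner_opField_left _
      isSkewSymmetric_Y := inner_opField_left _
      commutator := LinearMap.ext opField_commutator
      central := fun u => opField_central u
      ground_ne_zero := (map_ne_zero_iff _ schwartzVector_injective).2 fun hzero =>
        gaussian_apply_ne_zero _ 0 (DFunLike.congr_fun hzero 0)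
      lowering_ground := lowering_gaussian hc
      cyclic := fun u hu => eq_zero_of_gaussian_moments_eq_zero _ fun n =>
        (mul_eq_zero.1 ((inner_opField_pow_gaussian _ n u).symm.trans (hu n))).resolve_left
          (pow_ne_zero n (neg_ne_zero.2 Complex.two_pi_I_ne_zero)) }

end GroundState

/-! ## Asymptotics and coincidences of the eigenvalues -/

section Counting

open Filter

theorem tendsto_sumElim_cofinite_cocompact {ι κ α : Type*} [TopologicalSpace α] {f : ι → α}
    {g : κ → α} (hf : Tendsto f cofinite (cocompact α)) (hg : Tendsto g cofinite (cocompact α)) :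
    Tendsto (Sum.elim f g) cofinite (cocompact α) := by
  rw [tendsto_cofinite_cocompact_iff] at *
  exact fun s hs => Set.finite_preimage_inl_and_inr.1 ⟨hf s hs, hg s hs⟩

theorem ncard_sum {α β : Type*} {s : Set (α ⊕ β)} (hs : s.Finite) :
    s.ncard = (Sum.inl ⁻¹' s).ncard + (Sum.inr ⁻¹' s).ncard := by
  obtain ⟨hl, hr⟩ := Set.finite_preimage_inl_and_inr.2 hs
  have hdisj : Disjoint (Sum.inl '' (Sum.inl ⁻¹' s)) (Sum.inr '' (Sum.inr ⁻¹' s)) :=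
    Set.disjoint_image_inl_image_inr
  rw [← Set.ncard_image_of_injective (Sum.inl ⁻¹' s) Sum.inl_injective,
    ← Set.ncard_image_of_injective (Sum.inr ⁻¹' s) Sum.inr_injective,
    ← Set.ncard_union_eq hdisj (hl.image _) (hr.image _),
    Set.image_preimage_inl_union_image_preimage_inr]

theorem IsDiagonal.eigenMultiplicity_closure_eq_one {K ι : Type*} [NormedAddCommGroup K]
    [InnerProductSpace ℂ K] [CompleteSpace K] {S : K →ₗ.[ℂ] K} {b : HilbertBasis ι ℂ K}
    {l : ι → ℝ} (H : IsDiagonal S b l) (hl : Tendsto l cofinite (cocompact ℝ))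
    (hinj : Function.Injective l) {z : ℂ} (hz : z ∈ unboundedSpectrum S.closure) :
    eigenMultiplicity S.closure z = 1 := by
  rw [H.unboundedSpectrum_closure_of_tendsto hl] at hz
  obtain ⟨_, ⟨j, rfl⟩, rfl⟩ := hz
  have hfiber : {i | l i = l j} = {j} := Set.ext fun i => hinj.eq_iff
  simp only
  rw [H.eigenMultiplicity_closure _ (hfiber ▸ Set.finite_singleton j), hfiber, Set.ncard_singleton]

variable {k : ℝ}

theorem range_eigA : Set.range (eigA k) = functionSpectrum k :=
  Set.ext fun _ => exists_congr fun _ => eq_comm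

theorem range_formValue : Set.range (formValue k) = oneFormSpectrum k := by
  have hminus : k ^ 2 = eigMinus k 0 := by
    rw [eigMinus_eq, rootA_zero, add_sub_cancel_right, sq_abs]
  have hplus : (|k| + 1) ^ 2 = eigPlus k 0 := by
    rw [eigPlus_eq, rootA_zero, add_assoc, add_halves]
  ext x
  constructor
  · rintro ⟨n | n | n, rfl⟩
    · exact Or.inl (Or.inr ⟨n, rfl⟩)
    · exact Or.inr ⟨n, Or.inl rfl⟩
    · exact Or.inr ⟨n, Or.inr rfl⟩
  · rintro (((rfl | rfl) | ⟨n, rfl⟩) | ⟨n, rfl | rfl⟩)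
    · exact ⟨.inr (.inr 0), hminus.symm⟩
    · exact ⟨.inr (.inl 0), hplus.symm⟩
    · exact ⟨.inl n, rfl⟩
    · exact ⟨.inr (.inl n), rfl⟩
    · exact ⟨.inr (.inr n), rfl⟩

theorem tendsto_eigA_atTop (hk : k ≠ 0) : Tendsto (eigA k) atTop atTop :=
  tendsto_atTop_add_const_right _ _ <|
    (tendsto_atTop_add_const_right _ _
      (tendsto_natCast_atTop_atTop.const_mul_atTop two_pos)).atTop_mul_const (abs_pos.2 hk)

theorem tendsto_rootA_atTop (hk : k ≠ 0) : Tendsto (rootA k) atTop atTop := by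
  refine (Real.tendsto_sqrt_atTop.comp
    (tendsto_atTop_add_const_right _ (1 / 4) (tendsto_eigA_atTop hk))).congr fun n => ?_
  rw [Function.comp_apply, eigA, rootA, mul_comm |k|]

theorem tendsto_eigA (hk : k ≠ 0) : Tendsto (eigA k) cofinite (cocompact ℝ) := by
  rw [Nat.cofinite_eq_atTop]
  exact (tendsto_eigA_atTop hk).mono_right atTop_le_cocompact

theorem tendsto_formValue (hk : k ≠ 0) : Tendsto (formValue k) cofinite (cocompact ℝ) := by
  have hplus : Tendsto (eigPlus k) atTop atTop := (tendsto_pow_atTop two_ne_zero).comp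
    (tendsto_atTop_add_const_right _ (1 / 2) (tendsto_rootA_atTop hk))
  have hminus : Tendsto (eigMinus k) atTop atTop := (tendsto_pow_atTop two_ne_zero).comp
    (tendsto_atTop_add_const_right _ (-(1 / 2)) (tendsto_rootA_atTop hk))
  rw [← Nat.cofinite_eq_atTop] at hplus hminus
  exact tendsto_sumElim_cofinite_cocompact (tendsto_eigA hk) <|
    tendsto_sumElim_cofinite_cocompact (hplus.mono_right atTop_le_cocompact)
      (hminus.mono_right atTop_le_cocompact)

theorem finite_formValue_eq (hk : k ≠ 0) (x : ℝ) : {j | formValue k j = x}.Finite :=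
  tendsto_cofinite_cocompact_iff.1 (tendsto_formValue hk) {x} isCompact_singleton

theorem ncard_formValue_eq (hk : k ≠ 0) (x : ℝ) :
    {j | formValue k j = x}.ncard = oneFormCount k x := by
  have hfin := finite_formValue_eq hk x
  rw [ncard_sum hfin, ncard_sum (Set.finite_preimage_inl_and_inr.2 hfin).2, ← add_assoc]
  rfl

end Counting

section Irrational

variable {k : ℝ}

theorem rootA_sq_ne_of_irrational (hk : Irrational k) {n : ℕ} {c : ℤ} (hc : c = -1 → n ≠ 0) :
    rootA k n ^ 2 ≠ (c * |k| - 1 / 2) ^ 2 := by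
  intro heq
  have habs : Irrational |k| := by
    rcases abs_choice k with hchoice | hchoice <;> rw [hchoice]
    exacts [hk, hk.neg]
  have hlinear : ((c ^ 2 - 1 : ℤ) : ℝ) * |k| = ((2 * n + 1 + c : ℤ) : ℝ) := by
    refine mul_right_cancel₀ (abs_ne_zero.2 hk.ne_zero) ?_
    rw [rootA_sq, eigA] at heq
    push_cast
    linear_combination -heq - sq_abs k
  by_cases hsq : c ^ 2 - 1 = 0
  · rw [hsq, Int.cast_zero, zero_mul] at hlinear
    have hsum : 2 * (n : ℤ) + 1 + c = 0 := by exact_mod_cast hlinear.symm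
    rcases sq_eq_one_iff.1 (sub_eq_zero.1 hsq) with rfl | rfl <;> omega
  · exact (habs.intCast_mul hsq).ne_int _ hlinear

theorem eigA_ne_eigPlus (hk : Irrational k) (m n : ℕ) : eigA k m ≠ eigPlus k n := by
  intro heq
  refine rootA_sq_ne_of_irrational hk (n := n) (c := 2 * (m - n)) (by omega) ?_
  have hsq := rootA_sq k n
  rw [eigPlus_eq] at heq
  rw [eigA] at heq hsq
  congr 1
  push_cast
  linear_combination -heq - hsq

theorem eigA_ne_eigMinus (hk : Irrational k) (m n : ℕ) : eigA k m ≠ eigMinus k n := by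
  intro heq
  refine rootA_sq_ne_of_irrational hk (n := n) (c := 2 * (m - n)) (by omega) ?_
  have hsq := rootA_sq k n
  rw [eigMinus_eq] at heq
  rw [eigA] at heq hsq
  rw [← neg_sq]
  congr 1
  push_cast
  linear_combination -heq - hsq

theorem eigPlus_ne_eigMinus (hk : Irrational k) (m n : ℕ) : eigPlus k m ≠ eigMinus k n := by
  intro heq
  refine rootA_sq_ne_of_irrational hk (n := m) (c := n - m) (by omega) ?_
  have hm := abs_add_half_le_rootA hk.ne_zero m
  have hn := abs_add_half_le_rootA hk.ne_zero n
  have habs := abs_nonneg k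
  rw [eigPlus_eq, eigMinus_eq, sq_eq_sq₀ (by linarith) (by linarith)] at heq
  have hsqm := rootA_sq k m
  have hsqn := rootA_sq k n
  rw [eigA] at hsqm hsqn
  congr 1
  push_cast
  linear_combination (hsqn - hsqm) / 2 + (rootA k m + 1 + rootA k n) / 2 * heq

theorem eigPlus_injective (hk : k ≠ 0) : Function.Injective (eigPlus k) := fun m n heq => by
  have habs := abs_nonneg k
  have hm := abs_add_half_le_rootA hk m
  have hn := abs_add_half_le_rootA hk n
  rw [eigPlus_eq, eigPlus_eq, sq_eq_sq₀ (by linarith) (by linarith)] at heq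
  exact (rootA_strictMono hk).injective (add_right_cancel heq)

theorem eigMinus_injective (hk : k ≠ 0) : Function.Injective (eigMinus k) := fun m n heq => by
  have habs := abs_nonneg k
  have hm := abs_add_half_le_rootA hk m
  have hn := abs_add_half_le_rootA hk n
  rw [eigMinus_eq, eigMinus_eq, sq_eq_sq₀ (by linarith) (by linarith)] at heq
  exact (rootA_strictMono hk).injective (sub_left_injective heq)

theorem formValue_injective (hk : Irrational k) : Function.Injective (formValue k) :=
  (eigA_strictMono hk.ne_zero).injective.sumElim
    ((eigPlus_injective hk.ne_zero).sumElim (eigMinus_injective hk.ne_zero)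
      (eigPlus_ne_eigMinus hk))
    fun m j => by
      rcases j with n | n
      exacts [eigA_ne_eigPlus hk m n, eigA_ne_eigMinus hk m n]

end Irrational

section Diagonalisation

variable {h : ℝ}

theorem exists_isDiagonal_hodgeLaplacian0 (hh : h ≠ 0) : ∃ b : HilbertBasis ℕ ℂ (L2Forms 1),
    IsDiagonal (localiseSmooth h (hodgeLaplacian0 L2R)) b (eigA (2 * Real.pi * h)) := by
  obtain ⟨f₀, hfock⟩ := exists_isFockModel hh
  rw [hodgeLaplacian0_eq]
  exact exists_isDiagonal_localiseSmooth
    (intertwines_lapMatrix0 (leftField_smoothOrbit _) (leftField_smoothOrbit _)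
      (leftField_smoothOrbit _))
    (isMatrixAdjoint_lapMatrix0 hfock.isSkewSymmetric_X hfock.isSkewSymmetric_Y
      hfock.isSkewSymmetric_T)
    hfock.isOrthogonalBasis_ladder hfock.matrixAct_lapMatrix0_ladder

theorem exists_isDiagonal_hodgeLaplacian1 (hh : h ≠ 0) :
    ∃ b : HilbertBasis (ℕ ⊕ (ℕ ⊕ ℕ)) ℂ (L2Forms 3),
      IsDiagonal (localiseSmooth h (hodgeLaplacian1 L2R)) b (formValue (2 * Real.pi * h)) := by
  obtain ⟨f₀, hfock⟩ := exists_isFockModel hh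
  rw [hodgeLaplacian1_eq]
  exact exists_isDiagonal_localiseSmooth
    (intertwines_lapMatrix1 (leftField_smoothOrbit _) (leftField_smoothOrbit _)
      (leftField_smoothOrbit _))
    (isMatrixAdjoint_lapMatrix1 hfock.isSkewSymmetric_X hfock.isSkewSymmetric_Y
      hfock.isSkewSymmetric_T)
    hfock.isOrthogonalBasis_formVector hfock.matrixAct_lapMatrix1_formVector

theorem exists_isDiagonal_hodgeLaplacian2 (hh : h ≠ 0) :
    ∃ b : HilbertBasis (ℕ ⊕ (ℕ ⊕ ℕ)) ℂ (L2Forms 3),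
      IsDiagonal (localiseSmooth h (hodgeLaplacian2 L2R)) b (formValue (2 * Real.pi * h)) := by
  obtain ⟨f₀, hfock⟩ := exists_isFockModel hh
  have hbasis := hfock.isOrthogonalBasis_formVector.map_linearIsometryEquiv (starIsometry L2R)
  simp only [Function.comp_def, ← toForms_matrixAct_starMatrix] at hbasis
  have hadj := (isMatrixAdjoint_starMatrix.mul (isMatrixAdjoint_lapMatrix1 hfock.isSkewSymmetric_X
    hfock.isSkewSymmetric_Y hfock.isSkewSymmetric_T)).mul isMatrixAdjoint_starMatrix
  rw [← Matrix.mul_assoc] at hadj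
  rw [hodgeLaplacian2_eq]
  refine exists_isDiagonal_localiseSmooth ((intertwines_starMatrix.mul
    (intertwines_lapMatrix1 (leftField_smoothOrbit _) (leftField_smoothOrbit _)
      (leftField_smoothOrbit _))).mul intertwines_starMatrix) hadj hbasis fun j => ?_
  rw [← LinearMap.comp_apply, ← matrixAct_mul, Matrix.mul_assoc, starMatrix_mul_self,
    Matrix.mul_one, matrixAct_mul, LinearMap.comp_apply,
    hfock.matrixAct_lapMatrix1_formVector, map_smul]

end Diagonalisation

end HeisenbergHodge

end

open HeisenbergHodge in
theorem mainTheorem6 (h k : ℝ) (hh : h ≠ 0) (hk : k = 2 * Real.pi * h) :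
    -- the spectra
    unboundedSpectrum (localise h (hodgeLaplacian0 L2R)) =
      (fun x : ℝ => (x : ℂ)) '' functionSpectrum k ∧
    unboundedSpectrum (localise h (hodgeLaplacian1 L2R)) =
      (fun x : ℝ => (x : ℂ)) '' oneFormSpectrum k ∧
    unboundedSpectrum (localise h (hodgeLaplacian2 L2R)) =
      unboundedSpectrum (localise h (hodgeLaplacian1 L2R)) ∧
    unboundedSpectrum (localise h (hodgeLaplacian3 L2R)) =
      unboundedSpectrum (localise h (hodgeLaplacian0 L2R)) ∧
    -- multiplicity one in degrees 0 and 3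
    (∀ z ∈ unboundedSpectrum (localise h (hodgeLaplacian0 L2R)),
      eigenMultiplicity (localise h (hodgeLaplacian0 L2R)) z = 1) ∧
    (∀ z ∈ unboundedSpectrum (localise h (hodgeLaplacian3 L2R)),
      eigenMultiplicity (localise h (hodgeLaplacian3 L2R)) z = 1) ∧
    -- in degrees 1 and 2, each entry of the list of eigenvalues counts once
    (∀ x : ℝ, eigenMultiplicity (localise h (hodgeLaplacian1 L2R)) (x : ℂ) = oneFormCount k x) ∧
    (∀ x : ℝ, eigenMultiplicity (localise h (hodgeLaplacian2 L2R)) (x : ℂ) = oneFormCount k x) ∧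
    -- multiplicity one in degrees 1 and 2 when no two entries coincide
    (Irrational k →
      (∀ z ∈ unboundedSpectrum (localise h (hodgeLaplacian1 L2R)),
        eigenMultiplicity (localise h (hodgeLaplacian1 L2R)) z = 1) ∧
      (∀ z ∈ unboundedSpectrum (localise h (hodgeLaplacian2 L2R)),
        eigenMultiplicity (localise h (hodgeLaplacian2 L2R)) z = 1)) := by
  subst hk
  have hk := mul_ne_zero Real.two_pi_pos.ne' hh
  obtain ⟨b₀, h₀⟩ := exists_isDiagonal_hodgeLaplacian0 hh
  obtain ⟨b₁, h₁⟩ := exists_isDiagonal_hodgeLaplacian1 hh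
  obtain ⟨b₂, h₂⟩ := exists_isDiagonal_hodgeLaplacian2 hh
  have hfun := tendsto_eigA hk
  have hform := tendsto_formValue hk
  have hcount := ncard_formValue_eq hk
  have hfinite := finite_formValue_eq hk
  have hspec₁ := h₁.unboundedSpectrum_closure_of_tendsto hform
  have hspec₂ := h₂.unboundedSpectrum_closure_of_tendsto hform
  have hone₀ := fun z => h₀.eigenMultiplicity_closure_eq_one hfun
    (eigA_strictMono hk).injective (z := z)
  rw [hodgeLaplacian3_eq_hodgeLaplacian0, ← range_eigA, ← range_formValue]
  exact ⟨h₀.unboundedSpectrum_closure_of_tendsto hfun, hspec₁, hspec₂.trans hspec₁.symm, rfl,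
    hone₀, hone₀, fun x => (h₁.eigenMultiplicity_closure x (hfinite x)).trans (hcount x),
    fun x => (h₂.eigenMultiplicity_closure x (hfinite x)).trans (hcount x), fun hirr =>
      ⟨fun _ => h₁.eigenMultiplicity_closure_eq_one hform (formValue_injective hirr),
        fun _ => h₂.eigenMultiplicity_closure_eq_one hform (formValue_injective hirr)⟩⟩
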